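/- \textbf{The theory.} $\mathbf{IKP}(\mathcal E)$ (intuitionistic exponentiation Kripke--Platek set theory) has formulas built from atoms $a\in b$ by $\neg,\wedge,\vee,\to$, the unbounded quantifiers $\forall x,\exists x$, the bounded quantifiers $(\forall x\in a),(\exists x\in a)$ and the exponentiation bounded quantifiers $(\forall x\in{}^{a}b),(\exists x\in{}^{a}b)$, all of them primitive; $a=b$ abbreviates $(\forall x\in a)(x\in b)\wedge(\forall x\in b)(x\in a)$, and $\mathrm{fun}(x,a,b)$ is the bounded formula saying that $x$ is a function from $a$ to $b$ (with Kuratowski pairs). A formula is $\Delta_0^{\mathcal E}$ if it has no unbounded quantifier. The $\Sigma^{\mathcal E}$- and $\Pi^{\mathcal E}$-formulas are the least classes that contain the $\Delta_0^{\mathcal E}$-formulas, are closed under $\wedge$, $\vee$, bounded and exponentiation bounded quantification, and such that: if $A$ is $\Sigma^{\mathcal E}$ and $C$ is $\Pi^{\mathcal E}$, then $\exists x A$, $\neg C$, $C\to A$ are $\Sigma^{\mathcal E}$; if $A$ is $\Pi^{\mathcal E}$ and $C$ is $\Sigma^{\mathcal E}$, then $\forall xA$, $\neg C$, $C\to A$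 are $\Pi^{\mathcal E}$. A sentence is a formula without free variables. $\mathbf{IKP}(\mathcal E)$ derives sequents $\Gamma\Rightarrow\Delta$ of finite sets of formulas, $\Delta$ having at most one element, by the intuitionistic sequent calculus with cut, where $(\exists x\in b)F(x)$ and $(\forall x\in b)F(x)$ are introduced from $a\in b\wedge F(a)$ and $a\in b\to F(a)$, and $(\exists x\in{}^{a}b)F(x)$ and $(\forall x\in{}^{a}b)F(x)$ from $\mathrm{fun}(c,a,b)\wedge F(c)$ and $\mathrm{fun}(c,a,b)\to F(c)$, with the usual eigenvariable conditions. Its axioms, with arbitrary side formulas $\Gamma$ on the left, are \begin{itemize} \item $\Gamma,A\Rightarrow A$ for $A\in\Delta_0^{\mathcal E}$; \item Extensionality: $a=b\wedge B(a)\to B(b)$ for $B\in\Delta_0^{\mathcal E}$; \item Pair: $\exists x[a\in x\wedge b\in x]$; \item Union: $\exists x(\forall y\in a)(\forall z\in y)(z\in x)$; \item Infinity: $\exists x[(\exists y\in x)\,y\in x\wedge(\forall y\in x)(\exists z\in x)\,y\in z]$; \item $\Delta_0^{\mathcal E}$-Separation: $\exists x\big((\forall y\in x)(y\in a\wedge A(y))\wedge(\forall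 y\in a)(A(y)\to y\in x)\big)$ for $A\in\Delta_0^{\mathcal E}$; \item $\Delta_0^{\mathcal E}$-Collection: $(\forall x\in a)\exists y\,B(x,y)\to\exists z(\forall x\in a)(\exists y\in z)B(x,y)$ for $B\in\Delta_0^{\mathcal E}$; \item Set Induction: $\forall u[(\forall x\in u)G(x)\to G(u)]\to\forall u\,G(u)$ for all formulas $G$; \item Exponentiation: $\exists z(\forall x\in{}^{a}b)(x\in z)$. \end{itemize} \textbf{Ordinals.} Let $\Omega=\aleph_1$, let $\varphi$ be the binary Veblen function ($\varphi 0\eta=\omega^\eta$), and define by simultaneous recursion on $\alpha$: $B^\Omega(\alpha)$ is the closure of $\{0,\Omega\}$ under $+$, $\varphi$ and $\xi\mapsto\psi_\Omega(\xi)$ for $\xi<\alpha$, and $\psi_\Omega(\alpha)=\min\{\rho<\Omega:\rho\notin B^\Omega(\alpha)\}$. Let $\varepsilon_{\Omega+1}$ be the least $\eta>\Omega$ with $\omega^\eta=\eta$. Ordinal terms are the terms in normal form built from $0,\Omega,+,\varphi,\psi_\Omega$ that denote the elements of $B^\Omega(\varepsilon_{\Omega+1})$; a term is in normal form if all its subterms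 are and: a sum $s+t$ has $s$ additively indecomposable, $t\neq 0$ and $t<s+t$; in $\varphi st$ one has $s,t<\varphi st$; in $\psi_\Omega(t)$ one has $t<\varepsilon_{\Omega+1}$ and $t\in B^\Omega(t)$. \textbf{The exponentiation hierarchy.} $E_0=\emptyset$; $E_1=\{\emptyset\}$; $E_{\alpha+2}$ consists of the sets definable over $\langle E_{\alpha+1},\in\rangle$ with parameters and of all functions $f\colon a\to b$ with $a,b\in E_\alpha$; for limit $\lambda$, $E_\lambda=\bigcup_{\beta<\lambda}E_\beta$ and $E_{\lambda+1}$ consists of the sets definable over $\langle E_\lambda,\in\rangle$ with parameters. $E_\alpha\models A$ means that $A$ holds in the structure $\langle E_\alpha,\in\rangle$, where $(\forall x\in{}^{a}b)$ and $(\exists x\in{}^{a}b)$ range over the elements of $E_\alpha$ that are functions from $a$ to $b$. \textbf{Theorem.} If $A$ is a $\Sigma^{\mathcal E}$-sentence and $\mathbf{IKP}(\mathcal E)\vdash\;\Rightarrow A$, then there is an ordinal term $\alpha<\psi_\Omega(\varepsilon_{\Omega+1})$, computable from the derivation, such that $E_\alpha\models A$. That is, there is a computable function $f$ such that for every $\Sigma^{\mathcal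 E}$-sentence $A$ and every derivation $d$ of $\Rightarrow A$ in $\mathbf{IKP}(\mathcal E)$, $f$ maps the Gödel number of $d$ to the Gödel number of an ordinal term denoting some $\alpha<\psi_\Omega(\varepsilon_{\Omega+1})$ with $E_\alpha\models A$. -/

import Mathlib

namespace IKPE

/-! ### The language of intuitionistic exponentiation Kripke–Platek set theory -/

/-- Variables available under `n` quantifiers: the free variables `a₀, a₁, …` and the bound
variables, given by de Bruijn indices (`bv 0` belongs to the innermost quantifier). -/
inductive Tm (n : ℕ) : Type
  | fv (i : ℕ) : Tm n
  | bv (k : Fin n) : Tm n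
  deriving DecidableEq

/-- Formulas of `IKP(𝓔)` under `n` quantifiers. The bounded quantifiers `(∀x ∈ t)`, `(∃x ∈ t)` and
the exponentiation bounded quantifiers `(∀x ∈ ˢt)`, `(∃x ∈ ˢt)` are primitive. -/
inductive Fml : ℕ → Type
  | mem {n : ℕ} (s t : Tm n) : Fml n
  | neg {n : ℕ} (A : Fml n) : Fml n
  | and {n : ℕ} (A B : Fml n) : Fml n
  | or {n : ℕ} (A B : Fml n) : Fml n
  | imp {n : ℕ} (A B : Fml n) : Fml n
  | all {n : ℕ} (F : Fml (n + 1)) : Fml n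
  | ex {n : ℕ} (F : Fml (n + 1)) : Fml n
  | ball {n : ℕ} (t : Tm n) (F : Fml (n + 1)) : Fml n
  | bex {n : ℕ} (t : Tm n) (F : Fml (n + 1)) : Fml n
  | eall {n : ℕ} (s t : Tm n) (F : Fml (n + 1)) : Fml n
  | eex {n : ℕ} (s t : Tm n) (F : Fml (n + 1)) : Fml n
  deriving DecidableEq

/-- Formulas in the proper sense: no dangling bound variable. -/
abbrev Formula : Type := Fml 0

/-- Simultaneous replacement of the bound variables. -/
def Tm.subst {n m : ℕ} (σ : Fin n → Tm m) : Tm n → Tm m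
  | .fv i => .fv i
  | .bv k => σ k

/-- Passing under one more quantifier. -/
def Tm.shift {n : ℕ} : Tm n → Tm (n + 1) := Tm.subst fun k => .bv k.succ

def upSubst {n m : ℕ} (σ : Fin n → Tm m) : Fin (n + 1) → Tm (m + 1) :=
  Fin.cases (.bv 0) fun k => (σ k).shift

def Fml.subst : {n m : ℕ} → (Fin n → Tm m) → Fml n → Fml m
  | _, _, σ, .mem s t => .mem (s.subst σ) (t.subst σ)
  | _, _, σ, .neg A => .neg (A.subst σ)
  | _, _, σ, .and A B => .and (A.subst σ) (B.subst σ)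
  | _, _, σ, .or A B => .or (A.subst σ) (B.subst σ)
  | _, _, σ, .imp A B => .imp (A.subst σ) (B.subst σ)
  | _, _, σ, .all F => .all (F.subst (upSubst σ))
  | _, _, σ, .ex F => .ex (F.subst (upSubst σ))
  | _, _, σ, .ball t F => .ball (t.subst σ) (F.subst (upSubst σ))
  | _, _, σ, .bex t F => .bex (t.subst σ) (F.subst (upSubst σ))
  | _, _, σ, .eall s t F => .eall (s.subst σ) (t.subst σ) (F.subst (upSubst σ))
  | _, _, σ, .eex s t F => .eex (s.subst σ) (t.subst σ) (F.subst (upSubst σ))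

/-- `F.app t` is `F(t)`, for a formula `F(x)` with one designated variable. -/
def Fml.app {m : ℕ} (F : Fml 1) (t : Tm m) : Fml m := F.subst fun _ => t

/-- `G.app₂ s t` is `G(s, t)`, for a formula `G(x, y)`; `x` is `bv 1` and `y` is `bv 0` in `G`. -/
def Fml.app₂ {m : ℕ} (G : Fml 2) (s t : Tm m) : Fml m := G.subst ![t, s]

/-- The free variables of a formula. -/
def Tm.fvs {n : ℕ} : Tm n → Finset ℕ
  | .fv i => {i}
  | .bv _ => ∅

def Fml.fvs : {n : ℕ} → Fml n → Finset ℕ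
  | _, .mem s t => s.fvs ∪ t.fvs
  | _, .neg A => A.fvs
  | _, .and A B => A.fvs ∪ B.fvs
  | _, .or A B => A.fvs ∪ B.fvs
  | _, .imp A B => A.fvs ∪ B.fvs
  | _, .all F => F.fvs
  | _, .ex F => F.fvs
  | _, .ball t F => t.fvs ∪ F.fvs
  | _, .bex t F => t.fvs ∪ F.fvs
  | _, .eall s t F => s.fvs ∪ t.fvs ∪ F.fvs
  | _, .eex s t F => s.fvs ∪ t.fvs ∪ F.fvs

/-- A sentence is a formula without free variables. -/
def IsSentence (A : Formula) : Prop := A.fvs = ∅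

/-- `Δ₀^𝓔`-formulas: no unbounded quantifier occurs. -/
def Fml.IsDelta0 : {n : ℕ} → Fml n → Prop
  | _, .mem _ _ => True
  | _, .neg A => A.IsDelta0
  | _, .and A B => A.IsDelta0 ∧ B.IsDelta0
  | _, .or A B => A.IsDelta0 ∧ B.IsDelta0
  | _, .imp A B => A.IsDelta0 ∧ B.IsDelta0
  | _, .all _ => False
  | _, .ex _ => False
  | _, .ball _ F => F.IsDelta0
  | _, .bex _ F => F.IsDelta0
  | _, .eall _ _ F => F.IsDelta0
  | _, .eex _ _ F => F.IsDelta0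

inductive Polarity : Type
  | sigma
  | pi

def Polarity.dual : Polarity → Polarity
  | .sigma => .pi
  | .pi => .sigma

/-- Simultaneous definition of the `Σ^𝓔`-formulas (`InClass .sigma`) and of the `Π^𝓔`-formulas
(`InClass .pi`). -/
inductive InClass : Polarity → {n : ℕ} → Fml n → Prop
  | delta0 {p : Polarity} {n : ℕ} {A : Fml n} : A.IsDelta0 → InClass p A
  | and {p : Polarity} {n : ℕ} {A B : Fml n} : InClass p A → InClass p B → InClass p (.and A B)
  | or {p : Polarity} {n : ℕ} {A B : Fml n} : InClass p A → InClass p B → InClass p (.or A B)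
  | ball {p : Polarity} {n : ℕ} {t : Tm n} {F : Fml (n + 1)} :
      InClass p F → InClass p (.ball t F)
  | bex {p : Polarity} {n : ℕ} {t : Tm n} {F : Fml (n + 1)} :
      InClass p F → InClass p (.bex t F)
  | eall {p : Polarity} {n : ℕ} {s t : Tm n} {F : Fml (n + 1)} :
      InClass p F → InClass p (.eall s t F)
  | eex {p : Polarity} {n : ℕ} {s t : Tm n} {F : Fml (n + 1)} :
      InClass p F → InClass p (.eex s t F)
  | ex {n : ℕ} {F : Fml (n + 1)} : InClass .sigma F → InClass .sigma (.ex F)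
  | all {n : ℕ} {F : Fml (n + 1)} : InClass .pi F → InClass .pi (.all F)
  | neg {p : Polarity} {n : ℕ} {C : Fml n} : InClass p.dual C → InClass p (.neg C)
  | imp {p : Polarity} {n : ℕ} {C A : Fml n} :
      InClass p.dual C → InClass p A → InClass p (.imp C A)

/-- `Σ^𝓔`-formulas. -/
def IsSigma (A : Formula) : Prop := InClass .sigma A

/-! ### Defined formulas -/

/-- `s = t`, i.e. `(∀x ∈ s)(x ∈ t) ∧ (∀x ∈ t)(x ∈ s)`. -/
def eqF {n : ℕ} (s t : Tm n) : Fml n :=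
  .and (.ball s (.mem (.bv 0) t.shift)) (.ball t (.mem (.bv 0) s.shift))

/-- `u = {y, z}`. -/
def upairF {n : ℕ} (u y z : Tm n) : Fml n :=
  .and (.mem y u) (.and (.mem z u) (.ball u (.or (eqF (.bv 0) y.shift) (eqF (.bv 0) z.shift))))

/-- `w = (y, z)`, with `(y, z) = {{y, z}, {y}}`: for some `u, v ∈ w`, `u = {y, z}`, `v = {y}` and
each `r ∈ w` is `u` or `v`. -/
def opairF {n : ℕ} (w y z : Tm n) : Fml n :=
  .bex w (.bex w.shift (.and (upairF (.bv 1) y.shift.shift z.shift.shift)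
    (.and (upairF (.bv 0) y.shift.shift y.shift.shift)
      (.ball w.shift.shift (.or (eqF (.bv 0) (.bv 2)) (eqF (.bv 0) (.bv 1)))))))

/-- `(y, z) ∈ x`. -/
def opairMemF {n : ℕ} (y z x : Tm n) : Fml n := .bex x (opairF (.bv 0) y.shift z.shift)

/-- `fun(x, a, b)`: `x ⊆ a × b`, `(∀y ∈ a)(∃z ∈ b) (y, z) ∈ x`, and
`(∀y ∈ a)(∀z₁ ∈ b)(∀z₂ ∈ b)[(y, z₁) ∈ x ∧ (y, z₂) ∈ x → z₁ = z₂]`. -/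
def funF {n : ℕ} (x a b : Tm n) : Fml n :=
  .and (.ball x (.bex a.shift (.bex b.shift.shift (opairF (.bv 2) (.bv 1) (.bv 0)))))
    (.and (.ball a (.bex b.shift (opairMemF (.bv 1) (.bv 0) x.shift.shift)))
      (.ball a (.ball b.shift (.ball b.shift.shift
        (.imp
          (.and (opairMemF (.bv 2) (.bv 1) x.shift.shift.shift)
            (opairMemF (.bv 2) (.bv 0) x.shift.shift.shift))
          (eqF (.bv 1) (.bv 0)))))))

/-! ### The axioms -/

/-- `a = b ∧ B(a) → B(b)`. -/
def extAx (a b : ℕ) (B : Fml 1) : Formula :=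
  .imp (.and (eqF (.fv a) (.fv b)) (B.app (.fv a))) (B.app (.fv b))

/-- `∃x[a ∈ x ∧ b ∈ x]`. -/
def pairAx (a b : ℕ) : Formula := .ex (.and (.mem (.fv a) (.bv 0)) (.mem (.fv b) (.bv 0)))

/-- `∃x(∀y ∈ a)(∀z ∈ y)(z ∈ x)`. -/
def unionAx (a : ℕ) : Formula :=
  .ex (.ball (.fv a) (.ball (.bv 0) (.mem (.bv 0) (.bv 2))))

/-- `∃x[(∃y ∈ x) y ∈ x ∧ (∀y ∈ x)(∃z ∈ x) y ∈ z]`. -/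
def infAx : Formula :=
  .ex (.and (.bex (.bv 0) (.mem (.bv 0) (.bv 1)))
    (.ball (.bv 0) (.bex (.bv 1) (.mem (.bv 1) (.bv 0)))))

/-- `∃x((∀y ∈ x)(y ∈ a ∧ A(y)) ∧ (∀y ∈ a)(A(y) → y ∈ x))`. -/
def sepAx (a : ℕ) (A : Fml 1) : Formula :=
  .ex (.and (.ball (.bv 0) (.and (.mem (.bv 0) (.fv a)) (A.app (.bv 0))))
    (.ball (.fv a) (.imp (A.app (.bv 0)) (.mem (.bv 0) (.bv 1)))))

/-- `(∀x ∈ a)∃y B(x, y) → ∃z(∀x ∈ a)(∃y ∈ z)B(x, y)`. -/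
def collAx (a : ℕ) (B : Fml 2) : Formula :=
  .imp (.ball (.fv a) (.ex (B.app₂ (.bv 1) (.bv 0))))
    (.ex (.ball (.fv a) (.bex (.bv 1) (B.app₂ (.bv 1) (.bv 0)))))

/-- `∀u[(∀x ∈ u)G(x) → G(u)] → ∀u G(u)`. -/
def indAx (G : Fml 1) : Formula :=
  .imp (.all (.imp (.ball (.bv 0) (G.app (.bv 0))) (G.app (.bv 0)))) (.all (G.app (.bv 0)))

/-- `∃z(∀x ∈ ᵃb)(x ∈ z)`. -/
def expAx (a b : ℕ) : Formula := .ex (.eall (.fv a) (.fv b) (.mem (.bv 0) (.bv 1)))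

/-! ### Derivations -/

/-- The variable `c` does not occur in the sequent `Γ ⇒ Δ`. -/
def Fresh (c : ℕ) (Γ : Finset Formula) (Δ : Option Formula) : Prop :=
  (∀ A ∈ Γ, c ∉ A.fvs) ∧ ∀ A ∈ Δ, c ∉ A.fvs

/-- Derivations of the intuitionistic sequent `Γ ⇒ Δ` in `IKP(𝓔)`: `Γ` is a finite set of formulas
and `Δ` has at most one element. -/
inductive Deriv : Finset Formula → Option Formula → Type
  -- axioms
  | logical (Γ : Finset Formula) (A : Formula) (h : A.IsDelta0) : Deriv (insert A Γ) (some A)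
  | ext (Γ : Finset Formula) (a b : ℕ) (B : Fml 1) (h : B.IsDelta0) : Deriv Γ (some (extAx a b B))
  | pair (Γ : Finset Formula) (a b : ℕ) : Deriv Γ (some (pairAx a b))
  | union (Γ : Finset Formula) (a : ℕ) : Deriv Γ (some (unionAx a))
  | infinity (Γ : Finset Formula) : Deriv Γ (some infAx)
  | sep (Γ : Finset Formula) (a : ℕ) (A : Fml 1) (h : A.IsDelta0) : Deriv Γ (some (sepAx a A))
  | coll (Γ : Finset Formula) (a : ℕ) (B : Fml 2) (h : B.IsDelta0) : Deriv Γ (some (collAx a B))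
  | ind (Γ : Finset Formula) (G : Fml 1) : Deriv Γ (some (indAx G))
  | exp (Γ : Finset Formula) (a b : ℕ) : Deriv Γ (some (expAx a b))
  -- propositional rules
  | andL₁ (Γ : Finset Formula) (Δ : Option Formula) (A B : Formula)
      (d : Deriv (insert A Γ) Δ) : Deriv (insert (.and A B) Γ) Δ
  | andL₂ (Γ : Finset Formula) (Δ : Option Formula) (A B : Formula)
      (d : Deriv (insert B Γ) Δ) : Deriv (insert (.and A B) Γ) Δ
  | andR (Γ : Finset Formula) (A B : Formula)
      (d : Deriv Γ (some A)) (e : Deriv Γ (some B)) : Deriv Γ (some (.and A B))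
  | orL (Γ : Finset Formula) (Δ : Option Formula) (A B : Formula)
      (d : Deriv (insert A Γ) Δ) (e : Deriv (insert B Γ) Δ) : Deriv (insert (.or A B) Γ) Δ
  | orR₁ (Γ : Finset Formula) (A B : Formula) (d : Deriv Γ (some A)) : Deriv Γ (some (.or A B))
  | orR₂ (Γ : Finset Formula) (A B : Formula) (d : Deriv Γ (some B)) : Deriv Γ (some (.or A B))
  | negL (Γ : Finset Formula) (A : Formula) (d : Deriv Γ (some A)) : Deriv (insert (.neg A) Γ) none
  | negR (Γ : Finset Formula) (A : Formula) (d : Deriv (insert A Γ) none) : Deriv Γ (some (.neg A))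
  | bot (Γ : Finset Formula) (A : Formula) (d : Deriv Γ none) : Deriv Γ (some A)
  | impL (Γ : Finset Formula) (Δ : Option Formula) (A B : Formula)
      (d : Deriv (insert B Γ) Δ) (e : Deriv Γ (some A)) : Deriv (insert (.imp A B) Γ) Δ
  | impR (Γ : Finset Formula) (A B : Formula)
      (d : Deriv (insert A Γ) (some B)) : Deriv Γ (some (.imp A B))
  -- rules for the bounded quantifiers
  | bexL (Γ : Finset Formula) (Δ : Option Formula) (a b : ℕ) (F : Fml 1)
      (h : Fresh a (insert (.bex (.fv b) F) Γ) Δ)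
      (d : Deriv (insert (.and (.mem (.fv a) (.fv b)) (F.app (.fv a))) Γ) Δ) :
      Deriv (insert (.bex (.fv b) F) Γ) Δ
  | bexR (Γ : Finset Formula) (a b : ℕ) (F : Fml 1)
      (d : Deriv Γ (some (.and (.mem (.fv a) (.fv b)) (F.app (.fv a))))) :
      Deriv Γ (some (.bex (.fv b) F))
  | ballL (Γ : Finset Formula) (Δ : Option Formula) (a b : ℕ) (F : Fml 1)
      (d : Deriv (insert (.imp (.mem (.fv a) (.fv b)) (F.app (.fv a))) Γ) Δ) :
      Deriv (insert (.ball (.fv b) F) Γ) Δ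
  | ballR (Γ : Finset Formula) (a b : ℕ) (F : Fml 1)
      (h : Fresh a Γ (some (.ball (.fv b) F)))
      (d : Deriv Γ (some (.imp (.mem (.fv a) (.fv b)) (F.app (.fv a))))) :
      Deriv Γ (some (.ball (.fv b) F))
  -- rules for the unbounded quantifiers
  | exL (Γ : Finset Formula) (Δ : Option Formula) (a : ℕ) (F : Fml 1)
      (h : Fresh a (insert (.ex F) Γ) Δ)
      (d : Deriv (insert (F.app (.fv a)) Γ) Δ) : Deriv (insert (.ex F) Γ) Δ
  | exR (Γ : Finset Formula) (a : ℕ) (F : Fml 1)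
      (d : Deriv Γ (some (F.app (.fv a)))) : Deriv Γ (some (.ex F))
  | allL (Γ : Finset Formula) (Δ : Option Formula) (a : ℕ) (F : Fml 1)
      (d : Deriv (insert (F.app (.fv a)) Γ) Δ) : Deriv (insert (.all F) Γ) Δ
  | allR (Γ : Finset Formula) (a : ℕ) (F : Fml 1)
      (h : Fresh a Γ (some (.all F)))
      (d : Deriv Γ (some (F.app (.fv a)))) : Deriv Γ (some (.all F))
  -- rules for the exponentiation bounded quantifiers
  | eexL (Γ : Finset Formula) (Δ : Option Formula) (c a b : ℕ) (F : Fml 1)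
      (h : Fresh c (insert (.eex (.fv a) (.fv b) F) Γ) Δ)
      (d : Deriv (insert (.and (funF (.fv c) (.fv a) (.fv b)) (F.app (.fv c))) Γ) Δ) :
      Deriv (insert (.eex (.fv a) (.fv b) F) Γ) Δ
  | eexR (Γ : Finset Formula) (c a b : ℕ) (F : Fml 1)
      (d : Deriv Γ (some (.and (funF (.fv c) (.fv a) (.fv b)) (F.app (.fv c))))) :
      Deriv Γ (some (.eex (.fv a) (.fv b) F))
  | eallL (Γ : Finset Formula) (Δ : Option Formula) (c a b : ℕ) (F : Fml 1)
      (d : Deriv (insert (.imp (funF (.fv c) (.fv a) (.fv b)) (F.app (.fv c))) Γ) Δ) :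
      Deriv (insert (.eall (.fv a) (.fv b) F) Γ) Δ
  | eallR (Γ : Finset Formula) (c a b : ℕ) (F : Fml 1)
      (h : Fresh c Γ (some (.eall (.fv a) (.fv b) F)))
      (d : Deriv Γ (some (.imp (funF (.fv c) (.fv a) (.fv b)) (F.app (.fv c))))) :
      Deriv Γ (some (.eall (.fv a) (.fv b) F))
  -- cut
  | cut (Γ : Finset Formula) (Δ : Option Formula) (A : Formula)
      (d : Deriv Γ (some A)) (e : Deriv (insert A Γ) Δ) : Deriv Γ Δ

/-! ### Gödel numbers -/

/-- The code of a finite sequence of natural numbers. -/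
def seqCode (l : List ℕ) : ℕ := Encodable.encode l

def Tm.code {n : ℕ} : Tm n → ℕ
  | .fv i => seqCode [0, i]
  | .bv k => seqCode [1, k.val]

def Fml.code : {n : ℕ} → Fml n → ℕ
  | _, .mem s t => seqCode [0, s.code, t.code]
  | _, .neg A => seqCode [1, A.code]
  | _, .and A B => seqCode [2, A.code, B.code]
  | _, .or A B => seqCode [3, A.code, B.code]
  | _, .imp A B => seqCode [4, A.code, B.code]
  | _, .all F => seqCode [5, F.code]
  | _, .ex F => seqCode [6, F.code]
  | _, .ball t F => seqCode [7, t.code, F.code]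
  | _, .bex t F => seqCode [8, t.code, F.code]
  | _, .eall s t F => seqCode [9, s.code, t.code, F.code]
  | _, .eex s t F => seqCode [10, s.code, t.code, F.code]

/-- The canonical index of a finite set of formulas. -/
def setCode (Γ : Finset Formula) : ℕ := ∑ A ∈ Γ, 2 ^ A.code

def optCode : Option Formula → ℕ
  | none => 0
  | some A => A.code + 1

/-- The Gödel number of a derivation: the rule of the last inference, the data of its instance and
the Gödel numbers of the derivations of its premises. -/
def Deriv.code : {Γ : Finset Formula} → {Δ : Option Formula} → Deriv Γ Δ → ℕ
  | _, _, .logical Γ A _ => seqCode [0, setCode Γ, A.code]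
  | _, _, .ext Γ a b B _ => seqCode [1, setCode Γ, a, b, B.code]
  | _, _, .pair Γ a b => seqCode [2, setCode Γ, a, b]
  | _, _, .union Γ a => seqCode [3, setCode Γ, a]
  | _, _, .infinity Γ => seqCode [4, setCode Γ]
  | _, _, .sep Γ a A _ => seqCode [5, setCode Γ, a, A.code]
  | _, _, .coll Γ a B _ => seqCode [6, setCode Γ, a, B.code]
  | _, _, .ind Γ G => seqCode [7, setCode Γ, G.code]
  | _, _, .exp Γ a b => seqCode [8, setCode Γ, a, b]
  | _, _, .andL₁ Γ Δ A B d => seqCode [9, setCode Γ, optCode Δ, A.code, B.code, d.code]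
  | _, _, .andL₂ Γ Δ A B d => seqCode [10, setCode Γ, optCode Δ, A.code, B.code, d.code]
  | _, _, .andR Γ A B d e => seqCode [11, setCode Γ, A.code, B.code, d.code, e.code]
  | _, _, .orL Γ Δ A B d e => seqCode [12, setCode Γ, optCode Δ, A.code, B.code, d.code, e.code]
  | _, _, .orR₁ Γ A B d => seqCode [13, setCode Γ, A.code, B.code, d.code]
  | _, _, .orR₂ Γ A B d => seqCode [14, setCode Γ, A.code, B.code, d.code]
  | _, _, .negL Γ A d => seqCode [15, setCode Γ, A.code, d.code]
  | _, _, .negR Γ A d => seqCode [16, setCode Γ, A.code, d.code]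
  | _, _, .bot Γ A d => seqCode [17, setCode Γ, A.code, d.code]
  | _, _, .impL Γ Δ A B d e => seqCode [18, setCode Γ, optCode Δ, A.code, B.code, d.code, e.code]
  | _, _, .impR Γ A B d => seqCode [19, setCode Γ, A.code, B.code, d.code]
  | _, _, .bexL Γ Δ a b F _ d => seqCode [20, setCode Γ, optCode Δ, a, b, F.code, d.code]
  | _, _, .bexR Γ a b F d => seqCode [21, setCode Γ, a, b, F.code, d.code]
  | _, _, .ballL Γ Δ a b F d => seqCode [22, setCode Γ, optCode Δ, a, b, F.code, d.code]
  | _, _, .ballR Γ a b F _ d => seqCode [23, setCode Γ, a, b, F.code, d.code]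
  | _, _, .exL Γ Δ a F _ d => seqCode [24, setCode Γ, optCode Δ, a, F.code, d.code]
  | _, _, .exR Γ a F d => seqCode [25, setCode Γ, a, F.code, d.code]
  | _, _, .allL Γ Δ a F d => seqCode [26, setCode Γ, optCode Δ, a, F.code, d.code]
  | _, _, .allR Γ a F _ d => seqCode [27, setCode Γ, a, F.code, d.code]
  | _, _, .eexL Γ Δ c a b F _ d => seqCode [28, setCode Γ, optCode Δ, c, a, b, F.code, d.code]
  | _, _, .eexR Γ c a b F d => seqCode [29, setCode Γ, c, a, b, F.code, d.code]
  | _, _, .eallL Γ Δ c a b F d => seqCode [30, setCode Γ, optCode Δ, c, a, b, F.code, d.code]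
  | _, _, .eallR Γ c a b F _ d => seqCode [31, setCode Γ, c, a, b, F.code, d.code]
  | _, _, .cut Γ Δ A d e => seqCode [32, setCode Γ, optCode Δ, A.code, d.code, e.code]

/-! ### Ordinals and ordinal terms -/

/-- `Ω = ℵ₁`. -/
noncomputable def Om : Ordinal.{0} := Ordinal.omega 1

/-- The closure of `{0, Ω}` under `+`, the Veblen function `φ` and `ξ ↦ p ξ` for `ξ < α`. -/
inductive Clos (α : Ordinal.{0}) (p : ∀ ξ : Ordinal.{0}, ξ < α → Ordinal.{0}) :
    Ordinal.{0} → Prop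
  | zero : Clos α p 0
  | Omega : Clos α p Om
  | add {ξ η : Ordinal.{0}} : Clos α p ξ → Clos α p η → Clos α p (ξ + η)
  | phi {ξ η : Ordinal.{0}} : Clos α p ξ → Clos α p η → Clos α p (Ordinal.veblen ξ η)
  | psi {ξ : Ordinal.{0}} (h : ξ < α) : Clos α p ξ → Clos α p (p ξ h)

/-- The collapsing function `ψ_Ω`: `psi α` is the least `ρ < Ω` outside `B^Ω(α)`. -/
noncomputable def psi (α : Ordinal.{0}) : Ordinal.{0} :=
  sInf {ρ | ρ < Om ∧ ¬ Clos α (fun ξ _ => psi ξ) ρ}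
termination_by α

/-- The set `B^Ω(α)`. -/
def BSet (α : Ordinal.{0}) : Set Ordinal.{0} := {ρ | Clos α (fun ξ _ => psi ξ) ρ}

/-- `ε_{Ω+1}`: the least `η > Ω` with `ω^η = η`. -/
noncomputable def epsOm : Ordinal.{0} := sInf {η | Om < η ∧ Ordinal.omega0 ^ η = η}

/-- Terms built from `0`, `Ω` by `+`, `φ`, `ψ_Ω`. -/
inductive OTerm : Type
  | zero : OTerm
  | Omega : OTerm
  | add (s t : OTerm) : OTerm
  | phi (s t : OTerm) : OTerm
  | psi (t : OTerm) : OTerm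

/-- The ordinal denoted by a term. -/
noncomputable def OTerm.val : OTerm → Ordinal.{0}
  | .zero => 0
  | .Omega => Om
  | .add s t => s.val + t.val
  | .phi s t => Ordinal.veblen s.val t.val
  | .psi t => IKPE.psi t.val

/-- The terms of the notation system for `B^Ω(ε_{Ω+1})`, i.e. the terms in normal form: a sum
`s + t` has `s` additively indecomposable, `t ≠ 0` and `s` not absorbed by `t`; in `φ s t` both
arguments are smaller than the value; `ψ t` has its argument below `ε_{Ω+1}` and in
`B^Ω` of itself. -/
def OTerm.IsNF : OTerm → Prop
  | .zero => True
  | .Omega => True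
  | .add s t => s.IsNF ∧ t.IsNF ∧ Ordinal.IsPrincipal (· + ·) s.val ∧ t.val ≠ 0 ∧
      t.val < s.val + t.val
  | .phi s t => s.IsNF ∧ t.IsNF ∧ s.val < Ordinal.veblen s.val t.val ∧
      t.val < Ordinal.veblen s.val t.val
  | .psi t => t.IsNF ∧ t.val < epsOm ∧ t.val ∈ BSet t.val

/-- The Gödel number of an ordinal term. -/
def OTerm.code : OTerm → ℕ
  | .zero => seqCode [0]
  | .Omega => seqCode [1]
  | .add s t => seqCode [2, s.code, t.code]
  | .phi s t => seqCode [3, s.code, t.code]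
  | .psi t => seqCode [4, t.code]

/-! ### Satisfaction and the exponentiation hierarchy -/

def Tm.eval {n : ℕ} (v : ℕ → ZFSet.{0}) (e : Fin n → ZFSet.{0}) : Tm n → ZFSet.{0}
  | .fv i => v i
  | .bv k => e k

/-- Satisfaction in the structure `⟨M, ∈⟩`: all quantifiers range over elements of `M`. The free
variables are interpreted by `v` and the dangling bound variables by `e`; `ZFSet.IsFunc a b x` says
that `x` is a function from `a` to `b`. -/
def Sat (M : Set ZFSet.{0}) (v : ℕ → ZFSet.{0}) : {n : ℕ} → (Fin n → ZFSet.{0}) → Fml n → Prop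
  | _, e, .mem s t => s.eval v e ∈ t.eval v e
  | _, e, .neg A => ¬ Sat M v e A
  | _, e, .and A B => Sat M v e A ∧ Sat M v e B
  | _, e, .or A B => Sat M v e A ∨ Sat M v e B
  | _, e, .imp A B => Sat M v e A → Sat M v e B
  | _, e, .all F => ∀ x ∈ M, Sat M v (Fin.cons x e) F
  | _, e, .ex F => ∃ x ∈ M, Sat M v (Fin.cons x e) F
  | _, e, .ball t F => ∀ x ∈ M, x ∈ t.eval v e → Sat M v (Fin.cons x e) F
  | _, e, .bex t F => ∃ x ∈ M, x ∈ t.eval v e ∧ Sat M v (Fin.cons x e) F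
  | _, e, .eall s t F =>
      ∀ x ∈ M, ZFSet.IsFunc (s.eval v e) (t.eval v e) x → Sat M v (Fin.cons x e) F
  | _, e, .eex s t F =>
      ∃ x ∈ M, ZFSet.IsFunc (s.eval v e) (t.eval v e) x ∧ Sat M v (Fin.cons x e) F

/-- `M ⊨ A`. For a sentence `A` the interpretation of the free variables plays no role. -/
def Models (M : Set ZFSet.{0}) (A : Formula) : Prop := Sat M (fun _ => ∅) Fin.elim0 A

/-- `X` is definable over `⟨M, ∈⟩` with parameters (the values in `M` of the free variables). -/
def DefinableOver (M : Set ZFSet.{0}) (X : ZFSet.{0}) : Prop :=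
  ∃ (F : Fml 1) (v : ℕ → ZFSet.{0}), (∀ i ∈ F.fvs, v i ∈ M) ∧
    ∀ x, x ∈ X ↔ x ∈ M ∧ Sat M v (fun _ => x) F

/-- The exponentiation hierarchy: `E_0 = ∅`; `E_{α+1}` consists of the sets definable over `E_α`
with parameters and, if `α = β + 1`, of the functions between elements of `E_β`;
`E_λ = ⋃_{β<λ} E_β` for limits `λ`. -/
def EHier (α : Ordinal.{0}) : Set ZFSet.{0} :=
  {X | (∃ β, ∃ _ : α = β + 1, DefinableOver (EHier β) X) ∨
    (∃ β, ∃ _ : α = β + 2, ∃ a ∈ EHier β, ∃ b ∈ EHier β, ZFSet.IsFunc a b X) ∨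
    (Order.IsSuccLimit α ∧ ∃ β, ∃ _ : β < α, X ∈ EHier β)}
termination_by α
decreasing_by all_goals (subst_vars; first | assumption | simp)

end IKPE

/-!
A countable `ξ` with `ω ^ ξ = ξ` satisfies `E_ξ = V_ξ`, and the values of `ψ_Ω` are such ordinals.
Each sequent derivable in `IKP(𝓔)` is derivable in an infinitary calculus with cuts of some finite
rank and height `Ω + m`, uniformly in the interpretation of the free variables and in the stage
`ξ`, the bound on the ranks of the sets that are mentioned. Eliminating the cuts down to those on
`Δ₀^𝓔`-formulas with at most one unbounded quantifier in front raises the height to a finite tower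
of exponentials of `Ω + 1`. A set of `Σ^𝓔`-formulas that is derived in this way at stage `ψ_Ω(γ)`
with height `α` contains a formula that is true at stage `ψ_Ω(γ + ω ^ α)`.

The Gödel number of the derivation bounds the cut rank, hence the height of the tower, and
`Ω + m < ω ^ (Ω + 1)` whatever `m` is. This makes the ordinal term computable.
-/

namespace IKPE

open Ordinal

/-! ### The function ψ -/

section Collapse

variable {α β β' ρ ξ η : Ordinal.{0}}

theorem OTerm.code_injective : Function.Injective OTerm.code := by
  intro s
  induction s with
  | zero | Omega => intro t h; cases t <;> simp_all [OTerm.code, seqCode]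
  | add a b iha ihb | phi a b iha ihb =>
    intro t h
    cases t <;> simp only [code, seqCode, Encodable.encode_inj, List.cons.injEq] at h
    all_goals first | (simp at h; done) | rw [iha h.2.1, ihb h.2.2.1]
  | psi a iha =>
    intro t h
    cases t <;> simp only [code, seqCode, Encodable.encode_inj, List.cons.injEq] at h
    all_goals first | (simp at h; done) | rw [iha h.2.1]

instance : Countable OTerm := OTerm.code_injective.countable

theorem BSet_subset_range_val : BSet α ⊆ Set.range OTerm.val := by
  intro ρ hρ
  induction hρ with
  | zero => exact ⟨.zero, rfl⟩
  | Omega => exact ⟨.Omega, rfl⟩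
  | add _ _ ih ih' =>
    obtain ⟨⟨s, rfl⟩, ⟨t, rfl⟩⟩ := And.intro ih ih'
    exact ⟨.add s t, rfl⟩
  | phi _ _ ih ih' =>
    obtain ⟨⟨s, rfl⟩, ⟨t, rfl⟩⟩ := And.intro ih ih'
    exact ⟨.phi s t, rfl⟩
  | psi _ _ ih =>
    obtain ⟨s, rfl⟩ := ih
    exact ⟨.psi s, rfl⟩

theorem countable_BSet (α : Ordinal.{0}) : (BSet α).Countable :=
  (Set.countable_range _).mono BSet_subset_range_val

theorem omega0_lt_Om : ω < Om := omega0_lt_omega_one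

theorem exists_lt_Om_notMem_BSet (α : Ordinal.{0}) : ∃ ρ, ρ < Om ∧ ρ ∉ BSet α := by
  by_contra! h
  have : Countable ↥(BSet α ∩ Set.Iio Om) := ((countable_BSet α).mono Set.inter_subset_left)
  have hsup : ⨆ ρ : ↥(BSet α ∩ Set.Iio Om), (ρ : Ordinal.{0}) + 1 < Om :=
    iSup_lt_omega_one fun ρ =>
      isPrincipal_add_omega 1 ρ.2.2 (one_lt_omega0.trans omega0_lt_Om)
  have hle := Ordinal.le_iSup (fun ρ : ↥(BSet α ∩ Set.Iio Om) => (ρ : Ordinal.{0}) + 1)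
    ⟨_, h _ hsup, hsup⟩
  exact (lt_add_one _).not_ge hle

theorem psi_mem (α : Ordinal.{0}) : psi α ∈ {ρ | ρ < Om ∧ ρ ∉ BSet α} := by
  rw [psi]
  exact csInf_mem (exists_lt_Om_notMem_BSet α)

theorem psi_lt_Om (α : Ordinal.{0}) : psi α < Om := (psi_mem α).1

theorem psi_notMem_BSet (α : Ordinal.{0}) : psi α ∉ BSet α := (psi_mem α).2

theorem mem_BSet_of_lt_psi (h : ρ < psi α) : ρ ∈ BSet α := by
  by_contra hρ
  refine h.not_ge ?_
  rw [psi]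
  exact csInf_le' ⟨h.trans (psi_lt_Om α), hρ⟩

theorem zero_mem_BSet (α : Ordinal.{0}) : 0 ∈ BSet α := Clos.zero

theorem Om_mem_BSet (α : Ordinal.{0}) : Om ∈ BSet α := Clos.Omega

theorem add_mem_BSet (hξ : ξ ∈ BSet α) (hη : η ∈ BSet α) : ξ + η ∈ BSet α := Clos.add hξ hη

theorem veblen_mem_BSet (hξ : ξ ∈ BSet α) (hη : η ∈ BSet α) : veblen ξ η ∈ BSet α :=
  Clos.phi hξ hη

theorem psi_mem_BSet (h : ξ < α) (hξ : ξ ∈ BSet α) : psi ξ ∈ BSet α :=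
  Clos.psi (p := fun ξ _ => psi ξ) h hξ

theorem omega0_opow_mem_BSet (hξ : ξ ∈ BSet α) : ω ^ ξ ∈ BSet α := by
  rw [← veblen_zero_apply]
  exact veblen_mem_BSet (zero_mem_BSet α) hξ

theorem one_mem_BSet (α : Ordinal.{0}) : 1 ∈ BSet α := by
  simpa using omega0_opow_mem_BSet (zero_mem_BSet α)

theorem BSet_mono : Monotone BSet := by
  intro α β h ρ hρ
  induction hρ with
  | zero => exact zero_mem_BSet β
  | Omega => exact Om_mem_BSet β
  | add _ _ ih ih' => exact add_mem_BSet ih ih'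
  | phi _ _ ih ih' => exact veblen_mem_BSet ih ih'
  | psi hlt _ ih => exact psi_mem_BSet (hlt.trans_le h) ih

theorem psi_mono : Monotone psi := by
  intro α β h
  by_contra! hlt
  exact psi_notMem_BSet β (BSet_mono h (mem_BSet_of_lt_psi hlt))

theorem isPrincipal_add_psi (α : Ordinal.{0}) : IsPrincipal (· + ·) (psi α) := by
  refine isPrincipal_add_iff_add_lt_ne_self.2 fun ξ hξ η hη h => psi_notMem_BSet α ?_
  rw [← h]
  exact add_mem_BSet (mem_BSet_of_lt_psi hξ) (mem_BSet_of_lt_psi hη)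

theorem psi_ne_zero (α : Ordinal.{0}) : psi α ≠ 0 := fun h =>
  psi_notMem_BSet α (h ▸ zero_mem_BSet α)

theorem omega0_opow_psi (α : Ordinal.{0}) : ω ^ psi α = psi α := by
  obtain h | ⟨μ, hμ⟩ := isPrincipal_add_iff_zero_or_omega0_opow.1 (isPrincipal_add_psi α)
  · exact absurd h (psi_ne_zero α)
  · replace hμ : ω ^ μ = psi α := hμ
    obtain hlt | heq := (right_le_opow μ one_lt_omega0).lt_or_eq
    · refine absurd (omega0_opow_mem_BSet (mem_BSet_of_lt_psi (hlt.trans_eq hμ))) ?_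
      rw [hμ]
      exact psi_notMem_BSet α
    · rw [← hμ, ← heq, ← heq]

theorem veblen_lt_psi (hξ : ξ < psi α) (hη : η < psi α) : veblen ξ η < psi α := by
  have hopow := omega0_opow_psi α
  have hveblen := veblen_invVeblen₁_invVeblen₂ (psi α)
  have harg := invVeblen₂_lt (psi α)
  rw [hopow] at hveblen harg
  obtain hlt | heq := (invVeblen₁_le (psi α)).lt_or_eq
  · have hmem := veblen_mem_BSet (mem_BSet_of_lt_psi hlt) (mem_BSet_of_lt_psi harg)
    rw [hveblen] at hmem
    exact absurd hmem (psi_notMem_BSet α)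
  · rw [heq] at hveblen
    have hfix : veblen (psi α) 0 = psi α :=
      ((veblen_le_veblen_iff_right.2 zero_le).trans_eq hveblen).antisymm (left_le_veblen _ _)
    rw [← hfix] at hη ⊢
    exact veblen_lt_veblen_iff.2 (Or.inr (Or.inl ⟨hξ, hη⟩))

theorem lt_psi_of_mem_BSet (h : ρ ∈ BSet α) (hρ : ρ < Om) : ρ < psi α := by
  induction h with
  | zero => exact pos_iff_ne_zero.2 (psi_ne_zero α)
  | Omega => exact absurd hρ (lt_irrefl _)
  | add _ _ ih ih' =>
    exact isPrincipal_add_psi α (ih (le_self_add.trans_lt hρ)) (ih' (le_add_self.trans_lt hρ))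
  | phi _ _ ih ih' =>
    exact veblen_lt_psi (ih ((left_le_veblen _ _).trans_lt hρ))
      (ih' ((right_le_veblen _ _).trans_lt hρ))
  | psi hlt hmem =>
    refine lt_of_le_of_ne (psi_mono hlt.le) fun heq => psi_notMem_BSet α ?_
    rw [← heq]
    exact psi_mem_BSet hlt hmem

theorem omega0_opow_lt_opow (h : α < β) : ω ^ α < ω ^ β :=
  (opow_lt_opow_iff_right one_lt_omega0).2 h

theorem add_opow_lt_add_opow (hβ : β < α) : ρ + ω ^ β < ρ + ω ^ α :=
  add_lt_add_right (omega0_opow_lt_opow hβ) ρ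

theorem add_opow_add_one_add_opow_lt (hβ : β < α) (hβ' : β' < α) :
    ρ + ω ^ β + 1 + ω ^ β' < ρ + ω ^ α := by
  have hadd := isPrincipal_add_omega0_opow α
  have hone : 1 < ω ^ α := by simpa using omega0_opow_lt_opow (zero_le.trans_lt hβ)
  simpa only [add_assoc] using
    add_lt_add_right (hadd (omega0_opow_lt_opow hβ) (hadd hone (omega0_opow_lt_opow hβ'))) ρ

theorem psi_lt_psi (h : α < β) (hα : α ∈ BSet β) : psi α < psi β :=
  lt_psi_of_mem_BSet (psi_mem_BSet h hα) (psi_lt_Om α)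

/-- The countable epsilon numbers. These are the stages at which the exponentiation hierarchy
agrees with the cumulative hierarchy, and the values of `psi` are among them. -/
structure IsCountableEpsilon (ξ : Ordinal.{0}) : Prop where
  lt_Om : ξ < Om
  omega0_opow_eq : ω ^ ξ = ξ

theorem isCountableEpsilon_psi (α : Ordinal.{0}) : IsCountableEpsilon (psi α) :=
  ⟨psi_lt_Om α, omega0_opow_psi α⟩

namespace IsCountableEpsilon

variable (hξ : IsCountableEpsilon ξ)
include hξ

theorem opow_lt (hα : α < ξ) : ω ^ α < ξ := by
  rw [← hξ.omega0_opow_eq]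
  exact omega0_opow_lt_opow hα

theorem add_lt (hα : α < ξ) (hβ : β < ξ) : α + β < ξ := by
  have h := isPrincipal_add_omega0_opow ξ
  rw [hξ.omega0_opow_eq] at h
  exact h hα hβ

theorem pos : 0 < ξ := by
  rw [← hξ.omega0_opow_eq]
  exact opow_pos _ omega0_pos

theorem one_lt : 1 < ξ := by simpa using hξ.opow_lt hξ.pos

theorem omega0_lt : ω < ξ := by simpa using hξ.opow_lt hξ.one_lt

theorem add_one_lt (hα : α < ξ) : α + 1 < ξ := hξ.add_lt hα hξ.one_lt

theorem natCast_lt (n : ℕ) : (n : Ordinal.{0}) < ξ := (natCast_lt_omega0 n).trans hξ.omega0_lt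

end IsCountableEpsilon

end Collapse

/-! ### Towers of exponentials -/

/-- The term for `Ω + 1` under `n` exponentials with base `ω`. The values of these terms are
cofinal in `ε_{Ω+1}`. -/
def towerTerm : ℕ → OTerm
  | 0 => .add .Omega (.phi .zero .zero)
  | n + 1 => .phi .zero (towerTerm n)

theorem val_towerTerm_zero : (towerTerm 0).val = Om + 1 := by
  simp [towerTerm, OTerm.val]

theorem val_towerTerm_succ (n : ℕ) : (towerTerm (n + 1)).val = ω ^ (towerTerm n).val := by
  simp [towerTerm, OTerm.val]

theorem val_towerTerm_mem_BSet (α : Ordinal.{0}) (n : ℕ) : (towerTerm n).val ∈ BSet α := by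
  induction n with
  | zero =>
    rw [val_towerTerm_zero]
    exact add_mem_BSet (Om_mem_BSet α) (one_mem_BSet α)
  | succ n ih =>
    rw [val_towerTerm_succ]
    exact omega0_opow_mem_BSet ih

theorem epsOm_mem : epsOm ∈ {η | Om < η ∧ ω ^ η = η} :=
  csInf_mem ⟨ε_ (Om + 1), (lt_add_one _).trans_le (right_le_veblen _ _), omega0_opow_epsilon _⟩

theorem val_towerTerm_lt_epsOm (n : ℕ) : (towerTerm n).val < epsOm := by
  obtain ⟨hlt, heq⟩ := epsOm_mem
  have hadd := isPrincipal_add_omega0_opow epsOm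
  rw [heq] at hadd
  induction n with
  | zero =>
    rw [val_towerTerm_zero]
    exact hadd hlt ((one_lt_omega0.trans omega0_lt_Om).trans hlt)
  | succ n ih =>
    rw [val_towerTerm_succ, ← heq]
    exact omega0_opow_lt_opow ih

theorem Om_lt_val_towerTerm (n : ℕ) : Om < (towerTerm n).val := by
  induction n with
  | zero =>
    rw [val_towerTerm_zero]
    exact lt_add_one _
  | succ n ih =>
    rw [val_towerTerm_succ]
    exact ih.trans_le (right_le_opow _ one_lt_omega0)

theorem strictMono_val_towerTerm : StrictMono fun n => (towerTerm n).val := by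
  refine strictMono_nat_of_lt_succ fun n => ?_
  rw [val_towerTerm_succ]
  refine (right_le_opow _ one_lt_omega0).lt_of_ne fun h => ?_
  exact (val_towerTerm_lt_epsOm n).not_ge (csInf_le' ⟨Om_lt_val_towerTerm n, h.symm⟩)

theorem val_towerTerm_add_lt {k l n : ℕ} (hk : k ≤ n) (hl : l ≤ n) :
    (towerTerm k).val + (towerTerm l).val < (towerTerm (n + 1)).val := by
  have hlt {j : ℕ} (hj : j ≤ n) := strictMono_val_towerTerm (Nat.lt_succ_of_le hj)
  have hadd := isPrincipal_add_omega0_opow (towerTerm n).val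
  rw [← val_towerTerm_succ] at hadd
  exact hadd (hlt hk) (hlt hl)

theorem Om_add_natCast_lt_val_towerTerm (m : ℕ) : Om + m < (towerTerm 1).val := by
  have hadd := isPrincipal_add_omega0_opow (towerTerm 0).val
  rw [← val_towerTerm_succ] at hadd
  exact hadd (Om_lt_val_towerTerm 1)
    (((natCast_lt_omega0 m).trans omega0_lt_Om).trans (Om_lt_val_towerTerm 1))

theorem isNF_towerTerm (n : ℕ) : (towerTerm n).IsNF := by
  induction n with
  | zero =>
    refine ⟨trivial, ⟨trivial, trivial, ?_, ?_⟩, isPrincipal_add_omega 1, ?_, ?_⟩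
    · simp [OTerm.val]
    · simp [OTerm.val]
    · simp [OTerm.val]
    · simp only [OTerm.val, veblen_zero_apply, opow_zero]
      exact (one_lt_omega0.trans omega0_lt_Om).trans (lt_add_one _)
  | succ n ih => exact ⟨trivial, ih, veblen_pos, strictMono_val_towerTerm n.lt_succ_self⟩

theorem isNF_psi_towerTerm (n : ℕ) : (OTerm.psi (towerTerm n)).IsNF :=
  ⟨isNF_towerTerm n, val_towerTerm_lt_epsOm n, val_towerTerm_mem_BSet _ n⟩

theorem psi_val_towerTerm_lt (n : ℕ) : psi (towerTerm n).val < psi epsOm :=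
  psi_lt_psi (val_towerTerm_lt_epsOm n) (val_towerTerm_mem_BSet _ n)

theorem primrec_code_towerTerm : Primrec fun n => (towerTerm n).code := by
  have hstep : Primrec₂ fun _ c : ℕ => seqCode [3, OTerm.zero.code, c] :=
    Primrec.encode.comp (Primrec.list_cons.comp (Primrec.const 3)
      (Primrec.list_cons.comp (Primrec.const OTerm.zero.code)
        (Primrec.list_cons.comp Primrec.snd (Primrec.const []))))
  refine (Primrec.nat_rec₁ (towerTerm 0).code hstep).of_eq fun n => ?_
  induction n with
  | zero => rfl
  | succ n ih => simp only [ih]; rfl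

theorem primrec_code_psi_towerTerm : Primrec fun n => (OTerm.psi (towerTerm n)).code :=
  Primrec.encode.comp (Primrec.list_cons.comp (Primrec.const 4)
    (Primrec.list_cons.comp primrec_code_towerTerm (Primrec.const [])))

/-! ### Infinitary formulas -/

/-- Infinitary formulas in negation normal form. A conjunction or disjunction labelled `some S`
ranges over the set `S`; the label `none` marks an unbounded quantifier, whose range grows with the
stage at which it is evaluated. -/
inductive InfFml : Type 1
  | atom (p : Prop) : InfFml
  | conj (o : Option (Set ZFSet.{0})) (F : ZFSet.{0} → InfFml) : InfFml
  | disj (o : Option (Set ZFSet.{0})) (F : ZFSet.{0} → InfFml) : InfFml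

namespace InfFml

variable {δ δ' : Ordinal.{0}} {o : Option (Set ZFSet.{0})} {S : Set ZFSet.{0}} {x : ZFSet.{0}}
  {F : ZFSet.{0} → InfFml} {A : InfFml} {k l : ℕ}

/-- The domain of a quantifier with label `o` at stage `δ`. -/
def range (δ : Ordinal.{0}) : Option (Set ZFSet.{0}) → Set ZFSet.{0}
  | none => {x | x.rank < δ}
  | some S => S

@[simp] theorem mem_range_none : x ∈ range δ none ↔ x.rank < δ := Iff.rfl

@[simp] theorem range_some : range δ (some S) = S := rfl

theorem range_mono (h : δ ≤ δ') : range δ o ⊆ range δ' o := by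
  cases o with
  | none => exact fun x hx => hx.trans_le h
  | some S => exact subset_rfl

/-- The negation normal form of the negation. -/
def dual : InfFml → InfFml
  | atom p => atom (¬ p)
  | conj o F => disj o fun x => (F x).dual
  | disj o F => conj o fun x => (F x).dual

@[simp] theorem dual_dual (A : InfFml) : A.dual.dual = A := by
  induction A with
  | atom p => simp [dual]
  | conj o F ih => simp [dual, ih]
  | disj o F ih => simp [dual, ih]

/-- Truth at stage `δ`, where the unbounded quantifiers range over the sets of rank below `δ`. -/
def Holds (δ : Ordinal.{0}) : InfFml → Prop
  | atom p => p
  | conj o F => ∀ x ∈ range δ o, (F x).Holds δ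
  | disj o F => ∃ x ∈ range δ o, (F x).Holds δ

@[simp] theorem holds_dual : A.dual.Holds δ ↔ ¬ A.Holds δ := by
  induction A with
  | atom p => rfl
  | conj o F ih => simp [dual, Holds, ih]
  | disj o F ih => simp [dual, Holds, ih]

/-- Bounded formulas: no unbounded quantifier occurs. -/
inductive IsBdd : InfFml → Prop
  | atom (p : Prop) : IsBdd (atom p)
  | conj {S : Set ZFSet.{0}} {F : ZFSet.{0} → InfFml} (h : ∀ x, IsBdd (F x)) :
      IsBdd (conj (some S) F)
  | disj {S : Set ZFSet.{0}} {F : ZFSet.{0} → InfFml} (h : ∀ x, IsBdd (F x)) :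
      IsBdd (disj (some S) F)

theorem IsBdd.dual (h : A.IsBdd) : A.dual.IsBdd := by
  induction h with
  | atom p => exact .atom _
  | conj _ ih => exact .disj ih
  | disj _ ih => exact .conj ih

theorem IsBdd.holds_iff (h : A.IsBdd) (δ δ' : Ordinal.{0}) : A.Holds δ ↔ A.Holds δ' := by
  induction h with
  | atom p => rfl
  | conj _ ih => simp [Holds, ih]
  | disj _ ih => simp [Holds, ih]

/-- The infinitary counterparts of the `Σ`-formulas: no unbounded universal quantifier occurs. -/
inductive IsSig : InfFml → Prop
  | atom (p : Prop) : IsSig (atom p)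
  | conj {S : Set ZFSet.{0}} {F : ZFSet.{0} → InfFml} (h : ∀ x, IsSig (F x)) :
      IsSig (conj (some S) F)
  | disj {o : Option (Set ZFSet.{0})} {F : ZFSet.{0} → InfFml} (h : ∀ x, IsSig (F x)) :
      IsSig (disj o F)

theorem IsBdd.isSig (h : A.IsBdd) : A.IsSig := by
  induction h with
  | atom p => exact .atom _
  | conj _ ih => exact .conj ih
  | disj _ ih => exact .disj ih

theorem IsSig.holds_mono (h : A.IsSig) (hδ : δ ≤ δ') (hA : A.Holds δ) : A.Holds δ' := by
  induction h with
  | atom p => exact hA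
  | conj _ ih => exact fun x hx => ih x (hA x hx)
  | disj _ ih =>
    obtain ⟨x, hx, h⟩ := hA
    exact ⟨x, range_mono hδ hx, ih x h⟩

/-- `RankLE k C` says that at most `k` quantifiers or connectives of `C` lie above its subformulas
that are bounded or consist of one unbounded quantifier before a bounded formula. The formulas of
rank `0` are the cut formulas that survive cut elimination. -/
def RankLE : ℕ → InfFml → Prop
  | 0, C => C.IsBdd ∨ ∃ F, (∀ x, (F x).IsBdd) ∧ (C = conj none F ∨ C = disj none F)
  | k + 1, C => RankLE k C ∨ ∃ o F, (∀ x, RankLE k (F x)) ∧ (C = conj o F ∨ C = disj o F)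

theorem IsBdd.rankLE_zero (h : A.IsBdd) : RankLE 0 A := Or.inl h

theorem RankLE.mono (h : k ≤ l) (hA : RankLE k A) : RankLE l A := by
  induction h with
  | refl => exact hA
  | step _ ih => exact Or.inl ih

theorem RankLE.conj (hF : ∀ x, RankLE k (F x)) : RankLE (k + 1) (conj o F) :=
  Or.inr ⟨o, F, hF, Or.inl rfl⟩

theorem RankLE.disj (hF : ∀ x, RankLE k (F x)) : RankLE (k + 1) (disj o F) :=
  Or.inr ⟨o, F, hF, Or.inr rfl⟩

theorem RankLE.dual (h : RankLE k A) : RankLE k A.dual := by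
  induction k generalizing A with
  | zero =>
    obtain h | ⟨F, hF, rfl | rfl⟩ := h
    · exact Or.inl h.dual
    · exact Or.inr ⟨_, fun x => (hF x).dual, Or.inr rfl⟩
    · exact Or.inr ⟨_, fun x => (hF x).dual, Or.inl rfl⟩
  | succ k ih =>
    obtain h | ⟨o, F, hF, rfl | rfl⟩ := h
    · exact Or.inl (ih h)
    · exact .disj fun x => ih (hF x)
    · exact .conj fun x => ih (hF x)

end InfFml

open InfFml

/-! ### The infinitary calculus -/

/-- The closure of `ξ ∪ {Ω}` under addition and exponentiation with base `ω`. -/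
inductive Control (ξ : Ordinal.{0}) : Ordinal.{0} → Prop
  | base {ρ : Ordinal.{0}} (h : ρ < ξ) : Control ξ ρ
  | Omega : Control ξ Om
  | add {ρ σ : Ordinal.{0}} (hρ : Control ξ ρ) (hσ : Control ξ σ) : Control ξ (ρ + σ)
  | opow {ρ : Ordinal.{0}} (hρ : Control ξ ρ) : Control ξ (ω ^ ρ)

/-- Derivability of the sequent `Γ`, read disjunctively, with height at most `α` and cut formulas of
rank at most `k`. The ordinal `ξ` is the stage at which `Γ` is derived. The rule for conjunctions
asks for premises at all later stages that are countable epsilon numbers, and `Control` restricts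
the heights of the premises of the other rules. Bounded formulas that are true are axioms, and
there is a rule for collection. -/
inductive InfDeriv (k : ℕ) : Ordinal.{0} → Ordinal.{0} → Set InfFml → Prop
  | ax {ξ α : Ordinal.{0}} {Γ : Set InfFml} {A : InfFml} (hA : A.IsBdd) (hholds : A.Holds ξ)
      (hmem : A ∈ Γ) : InfDeriv k ξ α Γ
  | conj {ξ α : Ordinal.{0}} {Γ : Set InfFml} {o : Option (Set ZFSet.{0})}
      {F : ZFSet.{0} → InfFml} (β : Ordinal.{0} → ZFSet.{0} → Ordinal.{0})
      (hmem : conj o F ∈ Γ)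
      (hβ : ∀ ξ' ≥ ξ, IsCountableEpsilon ξ' → ∀ x ∈ range ξ' o, β ξ' x < α)
      (h : ∀ ξ' ≥ ξ, IsCountableEpsilon ξ' → ∀ x ∈ range ξ' o,
        InfDeriv k ξ' (β ξ' x) (insert (F x) Γ)) : InfDeriv k ξ α Γ
  | disj {ξ α β : Ordinal.{0}} {Γ : Set InfFml} {o : Option (Set ZFSet.{0})}
      {F : ZFSet.{0} → InfFml} {x : ZFSet.{0}} (hx : x ∈ range ξ o) (hmem : disj o F ∈ Γ)
      (hβ : β < α) (hc : Control ξ β) (h : InfDeriv k ξ β (insert (F x) Γ)) : InfDeriv k ξ α Γ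
  | coll {ξ α β : Ordinal.{0}} {Γ : Set InfFml} {S : Set ZFSet.{0}}
      {B : ZFSet.{0} → ZFSet.{0} → InfFml} (hB : ∀ x y, (B x y).IsBdd)
      (hmem : InfFml.disj none
        (fun z => .conj (some S) fun x => .disj (some {y | y ∈ z}) (B x)) ∈ Γ)
      (hβ : β < α) (hc : Control ξ β)
      (h : InfDeriv k ξ β (insert (.conj (some S) fun x => .disj none (B x)) Γ)) :
      InfDeriv k ξ α Γ
  | cut {ξ α β β' : Ordinal.{0}} {Γ : Set InfFml} {C : InfFml} (hC : RankLE k C)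
      (hβ : β < α) (hc : Control ξ β) (hβ' : β' < α) (hc' : Control ξ β')
      (h : InfDeriv k ξ β (insert C Γ)) (h' : InfDeriv k ξ β' (insert C.dual Γ)) :
      InfDeriv k ξ α Γ

section Calculus

variable {ξ ξ' ρ α α' β γ : Ordinal.{0}} {Γ Γ' Δ Θ : Set InfFml} {o : Option (Set ZFSet.{0})}
  {S : Set ZFSet.{0}} {F : ZFSet.{0} → InfFml} {x : ZFSet.{0}} {C D : InfFml} {k l : ℕ}

theorem Control.mono (h : ξ ≤ ξ') (hρ : Control ξ ρ) : Control ξ' ρ := by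
  induction hρ with
  | base hlt => exact .base (hlt.trans_le h)
  | Omega => exact .Omega
  | add _ _ ih ih' => exact .add ih ih'
  | opow _ ih => exact .opow ih

theorem Control.mem_BSet (h : Control (psi γ) ρ) : ρ ∈ BSet γ := by
  induction h with
  | base hlt => exact mem_BSet_of_lt_psi hlt
  | Omega => exact Om_mem_BSet γ
  | add _ _ ih ih' => exact add_mem_BSet ih ih'
  | opow _ ih => exact omega0_opow_mem_BSet ih

theorem Control.add_opow_mem_BSet (hc : Control (psi γ) β) (hγ : γ ∈ BSet γ) (h : γ ≤ ρ) :
    γ + ω ^ β ∈ BSet ρ :=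
  BSet_mono h (add_mem_BSet hγ (omega0_opow_mem_BSet hc.mem_BSet))

namespace InfDeriv

theorem weaken (h : InfDeriv k ξ α Γ) (hk : k ≤ l) (hξ : ξ ≤ ξ') (hα : α ≤ α') (hΓ : Γ ⊆ Γ') :
    InfDeriv l ξ' α' Γ' := by
  induction h generalizing ξ' α' Γ' with
  | ax hA hholds hmem => exact .ax hA ((hA.holds_iff _ _).1 hholds) (hΓ hmem)
  | conj β hmem hβ _ ih =>
    exact .conj β (hΓ hmem) (fun η hη hε x hx => (hβ η (hξ.trans hη) hε x hx).trans_le hα)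
      fun η hη hε x hx => ih η (hξ.trans hη) hε x hx le_rfl le_rfl (Set.insert_subset_insert hΓ)
  | disj hx hmem hβ hc _ ih =>
    exact .disj (range_mono hξ hx) (hΓ hmem) (hβ.trans_le hα) (hc.mono hξ)
      (ih hξ le_rfl (Set.insert_subset_insert hΓ))
  | coll hB hmem hβ hc _ ih =>
    exact .coll hB (hΓ hmem) (hβ.trans_le hα) (hc.mono hξ)
      (ih hξ le_rfl (Set.insert_subset_insert hΓ))
  | cut hC hβ hc hβ' hc' _ _ ih ih' =>
    exact .cut (hC.mono hk) (hβ.trans_le hα) (hc.mono hξ) (hβ'.trans_le hα) (hc'.mono hξ)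
      (ih hξ le_rfl (Set.insert_subset_insert hΓ)) (ih' hξ le_rfl (Set.insert_subset_insert hΓ))

theorem mono (h : InfDeriv k ξ α Γ) (hΓ : Γ ⊆ Γ') : InfDeriv k ξ α Γ' :=
  h.weaken le_rfl le_rfl le_rfl hΓ

theorem mono_height (h : InfDeriv k ξ α Γ) (hα : α ≤ α') : InfDeriv k ξ α' Γ :=
  h.weaken le_rfl le_rfl hα subset_rfl

theorem mono_stage (h : InfDeriv k ξ α Γ) (hξ : ξ ≤ ξ') : InfDeriv k ξ' α Γ :=
  h.weaken le_rfl hξ le_rfl subset_rfl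

theorem insert_subset_insert_insert (h : Δ ⊆ insert C Γ) (D : InfFml) :
    insert D Δ ⊆ insert C (insert D Γ) := by
  rw [Set.insert_comm]
  exact Set.insert_subset_insert h

theorem replace {ξ₀ : Ordinal.{0}} (hξ : IsCountableEpsilon ξ) (hξ₀ : ξ₀ ≤ ξ)
    (hax : C.IsBdd → C.Holds ξ₀ → ∃ D ∈ Θ, D.IsBdd ∧ D.Holds ξ₀)
    (hconj : ∀ o F, C = .conj o F → ∃ x ∈ range ξ₀ o, F x ∈ Θ)
    (hdisj : ∀ o F, C = .disj o F → ∃ S, o = some S ∧ ∀ x ∈ S, F x ∈ Θ)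
    (h : InfDeriv k ξ α Δ) (hΔ : Δ ⊆ insert C Γ) (hΘ : Θ ⊆ Γ) : InfDeriv k ξ α Γ := by
  have hΘ_insert {Γ : Set InfFml} (hΘ : Θ ⊆ Γ) (D : InfFml) : Θ ⊆ insert D Γ :=
    hΘ.trans (Set.subset_insert D Γ)
  induction h generalizing Γ with
  | ax hA hholds hmem =>
    obtain rfl | hmem := hΔ hmem
    · obtain ⟨D, hD, hbdd, hholds⟩ := hax hA ((hA.holds_iff _ _).1 hholds)
      exact .ax hbdd ((hbdd.holds_iff _ _).1 hholds) (hΘ hD)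
    · exact .ax hA hholds hmem
  | @conj ξ α Δ o F β hmem hβ _ ih =>
    have ih {η} (hη : η ≥ ξ) (hε) {x} (hx) := ih η hη hε x hx hε (hξ₀.trans hη)
      (insert_subset_insert_insert hΔ (F x)) (hΘ_insert hΘ (F x))
    obtain heq | hmem := hΔ hmem
    · obtain ⟨x, hx, hxΘ⟩ := hconj o F heq.symm
      have hx := range_mono hξ₀ hx
      have := ih le_rfl hξ hx
      rw [Set.insert_eq_of_mem (hΘ hxΘ)] at this
      exact this.mono_height (hβ ξ le_rfl hξ x hx).le
    · exact .conj β hmem hβ fun η hη hε x hx => ih hη hε hx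
  | @disj ξ α β Δ o F x hx hmem hβ hc _ ih =>
    have ih := ih hξ hξ₀ (insert_subset_insert_insert hΔ _) (hΘ_insert hΘ _)
    obtain heq | hmem := hΔ hmem
    · obtain ⟨S, rfl, hS⟩ := hdisj o F heq.symm
      rw [Set.insert_eq_of_mem (hΘ (hS x hx))] at ih
      exact ih.mono_height hβ.le
    · exact .disj hx hmem hβ hc ih
  | coll hB hmem hβ hc _ ih =>
    obtain heq | hmem := hΔ hmem
    · obtain ⟨_, h, -⟩ := hdisj _ _ heq.symm
      cases h
    · exact .coll hB hmem hβ hc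
        (ih hξ hξ₀ (insert_subset_insert_insert hΔ _) (hΘ_insert hΘ _))
  | cut hC hβ hc hβ' hc' _ _ ih ih' =>
    exact .cut hC hβ hc hβ' hc'
      (ih hξ hξ₀ (insert_subset_insert_insert hΔ _) (hΘ_insert hΘ _))
      (ih' hξ hξ₀ (insert_subset_insert_insert hΔ _) (hΘ_insert hΘ _))

theorem inv_conj (h : InfDeriv k ξ α (insert (.conj o F) Γ)) (hξ : IsCountableEpsilon ξ)
    (hx : x ∈ range ξ o) : InfDeriv k ξ α (insert (F x) Γ) := by
  refine replace (C := .conj o F) (Θ := {F x}) hξ le_rfl ?_ ?_ ?_ h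
    (Set.insert_subset_insert (Set.subset_insert _ _)) (by simp)
  · rintro (_ | hF | _) hholds
    exact ⟨F x, rfl, hF x, hholds x hx⟩
  · rintro _ _ ⟨⟩
    exact ⟨x, hx, rfl⟩
  · rintro _ _ ⟨⟩

theorem inv_disj (h : InfDeriv k ξ α (insert (.disj (some S) F) Γ))
    (hξ : IsCountableEpsilon ξ) : InfDeriv k ξ α (F '' S ∪ Γ) := by
  refine replace (C := .disj (some S) F) (Θ := F '' S) hξ le_rfl ?_ ?_ ?_ h
    (Set.insert_subset_insert Set.subset_union_right) Set.subset_union_left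
  · rintro (_ | _ | hF) ⟨x, hx, hholds⟩
    exact ⟨F x, ⟨x, hx, rfl⟩, hF x, hholds⟩
  · rintro _ _ ⟨⟩
  · rintro _ _ ⟨⟩
    exact ⟨S, rfl, fun x hx => ⟨x, hx, rfl⟩⟩

/-! ### Cut elimination -/

theorem reduce (hF : ∀ x, RankLE k (F x)) (hbasic : ¬ RankLE 0 (.disj o F))
    (hξ : IsCountableEpsilon ξ) (hc : Control ξ α)
    (h : InfDeriv k ξ α (insert (InfFml.disj o F).dual Γ)) (h' : InfDeriv k ξ β Δ)
    (hΔ : Δ ⊆ insert (.disj o F) Γ) : InfDeriv k ξ (α + β) Γ := by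
  have weak {Γ : Set InfFml} {ξ : Ordinal.{0}}
      (h : InfDeriv k ξ α (insert (InfFml.disj o F).dual Γ)) (D : InfFml) :
      InfDeriv k ξ α (insert (InfFml.disj o F).dual (insert D Γ)) :=
    h.mono (Set.insert_subset_insert (Set.subset_insert D Γ))
  induction h' generalizing Γ with
  | ax hA hholds hmem =>
    obtain rfl | hmem := hΔ hmem
    · exact absurd hA.rankLE_zero hbasic
    · exact .ax hA hholds hmem
  | conj β hmem hβ _ ih =>
    obtain heq | hmem := hΔ hmem
    · cases heq
    · exact .conj (fun η x => α + β η x) hmem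
        (fun η hη hε x hx => add_lt_add_right (hβ η hη hε x hx) α)
        fun η hη hε x hx => ih η hη hε x hx hε (hc.mono hη) (weak (h.mono_stage hη) _)
          (insert_subset_insert_insert hΔ _)
  | @disj ξ _ _ _ _ _ x hx hmem hβ hcβ _ ih =>
    have ih := ih hξ hc (weak h _) (insert_subset_insert_insert hΔ _)
    obtain heq | hmem := hΔ hmem
    · cases heq
      exact .cut (hF x) (add_lt_add_right hβ α) (.add hc hcβ) (add_lt_add_right hβ α)
        (.add hc hcβ) ih ((h.inv_conj hξ hx).mono_height le_self_add)
    · exact .disj hx hmem (add_lt_add_right hβ α) (.add hc hcβ) ih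
  | coll hB hmem hβ hcβ _ ih =>
    obtain heq | hmem := hΔ hmem
    · refine absurd ?_ hbasic
      rw [← heq]
      exact Or.inr ⟨_, fun z => .conj fun x => .disj (hB x), Or.inr rfl⟩
    · exact .coll hB hmem (add_lt_add_right hβ α) (.add hc hcβ)
        (ih hξ hc (weak h _) (insert_subset_insert_insert hΔ _))
  | cut hC hβ hcβ hβ' hcβ' _ _ ih ih' =>
    exact .cut hC (add_lt_add_right hβ α) (.add hc hcβ) (add_lt_add_right hβ' α) (.add hc hcβ')
      (ih hξ hc (weak h _) (insert_subset_insert_insert hΔ _))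
      (ih' hξ hc (weak h _) (insert_subset_insert_insert hΔ _))

theorem eliminate_cut {β' : Ordinal.{0}} (hC : RankLE (k + 1) C) (hξ : IsCountableEpsilon ξ)
    (hβ : β < α) (hc : Control ξ β) (hβ' : β' < α) (hc' : Control ξ β')
    (h : InfDeriv k ξ (ω ^ β) (insert C Γ)) (h' : InfDeriv k ξ (ω ^ β') (insert C.dual Γ)) :
    InfDeriv k ξ (ω ^ α) Γ := by
  have hlt := omega0_opow_lt_opow hβ
  have hlt' := omega0_opow_lt_opow hβ'
  have hadd := isPrincipal_add_omega0_opow α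
  by_cases hk : RankLE k C
  · exact .cut hk hlt (.opow hc) hlt' (.opow hc') h h'
  · have hbasic : ¬ RankLE 0 C := fun h0 => hk (h0.mono k.zero_le)
    obtain hC | ⟨o, F, hF, rfl | rfl⟩ := hC
    · exact absurd hC hk
    · have hbasic' : ¬ RankLE 0 (InfFml.conj o F).dual := fun h0 => hbasic (by
        simpa only [dual_dual] using h0.dual)
      rw [← dual_dual (.conj o F)] at h
      exact (reduce (fun x => (hF x).dual) hbasic' hξ (.opow hc) h h' subset_rfl).mono_height
        (hadd hlt hlt').le
    · exact (reduce hF hbasic hξ (.opow hc') h' h subset_rfl).mono_height (hadd hlt' hlt).le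

theorem eliminate (hξ : IsCountableEpsilon ξ) (h : InfDeriv (k + 1) ξ α Γ) :
    InfDeriv k ξ (ω ^ α) Γ := by
  induction h with
  | ax hA hholds hmem => exact .ax hA hholds hmem
  | conj β hmem hβ _ ih =>
    exact .conj (fun η x => ω ^ β η x) hmem
      (fun η hη hε x hx => omega0_opow_lt_opow (hβ η hη hε x hx))
      fun η hη hε x hx => ih η hη hε x hx hε
  | disj hx hmem hβ hc _ ih => exact .disj hx hmem (omega0_opow_lt_opow hβ) (.opow hc) (ih hξ)
  | coll hB hmem hβ hc _ ih => exact .coll hB hmem (omega0_opow_lt_opow hβ) (.opow hc) (ih hξ)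
  | cut hC hβ hc hβ' hc' _ _ ih ih' => exact eliminate_cut hC hξ hβ hc hβ' hc' (ih hξ) (ih' hξ)

/-! ### Collapsing -/

theorem inv_conj_of_rank_lt_psi (h : InfDeriv k (psi γ) α (insert (.conj none F) Γ))
    (hγ : γ ∈ BSet γ) (hc : Control (psi γ) β) (hx : x.rank < psi (γ + ω ^ β)) :
    InfDeriv k (psi (γ + ω ^ β + 1)) α (insert (F x) Γ) := by
  have hlt : γ + ω ^ β < γ + ω ^ β + 1 := lt_add_one _
  have hle : γ ≤ γ + ω ^ β + 1 := le_self_add.trans hlt.le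
  exact (h.mono_stage (psi_mono hle)).inv_conj (isCountableEpsilon_psi _)
    (hx.trans (psi_lt_psi hlt (hc.add_opow_mem_BSet hγ hle)))

/-- The statement of the collapsing theorem for derivations of height `α`: a derivable sequent of
`Σ`-formulas contains one that is true at stage `psi (γ + ω ^ α)`. -/
def Collapses (α : Ordinal.{0}) : Prop :=
  ∀ ⦃γ : Ordinal.{0}⦄ ⦃Γ : Set InfFml⦄, γ ∈ BSet γ → (∀ A ∈ Γ, A.IsSig) →
    InfDeriv 0 (psi γ) α Γ → ∃ A ∈ Γ, A.Holds (psi (γ + ω ^ α))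

theorem Collapses.holds_head (hα : Collapses α) (hle : γ + ω ^ α ≤ ρ)
    (hno : ∀ A ∈ Γ, ¬ A.Holds (psi ρ)) (hγ : γ ∈ BSet γ) (hΓ : ∀ A ∈ Γ, A.IsSig) (hC : C.IsSig)
    (h : InfDeriv 0 (psi γ) α (insert C Γ)) : C.Holds (psi (γ + ω ^ α)) := by
  obtain ⟨A, rfl | hA, hholds⟩ := hα hγ (Set.forall_mem_insert.2 ⟨hC, hΓ⟩) h
  · exact hholds
  · exact absurd ((hΓ A hA).holds_mono (psi_mono hle) hholds) (hno A hA)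

/-- The premise with the existential formula is collapsed first, and the other premise is then
inverted at the witness so found. -/
theorem exists_holds_of_cut (ih : ∀ β < α, Collapses β) {β' : Ordinal.{0}}
    (hF : ∀ x, (F x).IsBdd) (hγ : γ ∈ BSet γ) (hΓ : ∀ A ∈ Γ, A.IsSig) (hβ : β < α)
    (hc : Control (psi γ) β) (hβ' : β' < α)
    (h : InfDeriv 0 (psi γ) β (insert (.disj none F) Γ))
    (h' : InfDeriv 0 (psi γ) β' (insert (InfFml.disj none F).dual Γ)) :
    ∃ A ∈ Γ, A.Holds (psi (γ + ω ^ α)) := by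
  by_contra! hno
  obtain ⟨x, hx, hholds⟩ := (ih β hβ).holds_head (add_opow_lt_add_opow hβ).le hno hγ hΓ
    (.disj fun x => (hF x).isSig) h
  have hdual := (ih β' hβ').holds_head (add_opow_add_one_add_opow_lt hβ hβ').le hno
    (add_mem_BSet (hc.add_opow_mem_BSet hγ (le_self_add.trans le_self_add)) (one_mem_BSet _))
    hΓ (hF x).dual.isSig (h'.inv_conj_of_rank_lt_psi hγ hc hx)
  exact holds_dual.1 hdual (((hF x).holds_iff _ _).1 hholds)

theorem collapses (α : Ordinal.{0}) : Collapses α := by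
  induction α using WellFoundedLT.induction with
  | _ α ih =>
  intro γ Γ hγ hΓ h
  by_contra! hno
  have hlt {β : Ordinal.{0}} (hβ : β < α) : γ + ω ^ β < γ + ω ^ α := add_opow_lt_add_opow hβ
  have holds_premise {β : Ordinal.{0}} {C : InfFml} (hβ : β < α) (hC : C.IsSig)
      (h : InfDeriv 0 (psi γ) β (insert C Γ)) : C.Holds (psi (γ + ω ^ β)) :=
    (ih β hβ).holds_head (hlt hβ).le hno hγ hΓ hC h
  have holds {β : Ordinal.{0}} {C : InfFml} (hβ : β < α) (hC : C.IsSig)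
      (h : InfDeriv 0 (psi γ) β (insert C Γ)) : C.Holds (psi (γ + ω ^ α)) :=
    hC.holds_mono (psi_mono (hlt hβ).le) (holds_premise hβ hC h)
  cases h with
  | ax hA hholds hmem => exact hno _ hmem ((hA.holds_iff _ _).1 hholds)
  | conj β hmem hβ h =>
    obtain _ | hS := hΓ _ hmem
    have hε := isCountableEpsilon_psi γ
    exact hno _ hmem fun x hx => holds (hβ _ le_rfl hε x hx) (hS x) (h _ le_rfl hε x hx)
  | @disj _ _ _ _ _ _ x hx hmem hβ _ h =>
    obtain _ | _ | hS := hΓ _ hmem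
    exact hno _ hmem ⟨x, range_mono (psi_mono le_self_add) hx, holds hβ (hS x) h⟩
  | @coll _ _ β _ _ _ hB hmem hβ hc h =>
    have hholds := holds_premise hβ (.conj fun x => .disj fun y => (hB x y).isSig) h
    refine hno _ hmem ⟨ZFSet.vonNeumann (psi (γ + ω ^ β)), ?_, fun x hx => ?_⟩
    · simpa using psi_lt_psi (hlt hβ) (hc.add_opow_mem_BSet hγ le_self_add)
    · obtain ⟨y, hy, hyB⟩ := hholds x hx
      exact ⟨y, ZFSet.mem_vonNeumann.2 hy, ((hB x y).holds_iff _ _).1 hyB⟩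
  | cut hC hβ hc hβ' hc' h h' =>
    obtain hC | ⟨F, hF, rfl | rfl⟩ := hC
    · exact holds_dual.1 (holds hβ' hC.dual.isSig h') (holds hβ hC.isSig h)
    · rw [← dual_dual (.conj none F)] at h
      obtain ⟨A, hA, hholds⟩ :=
        exists_holds_of_cut ih (fun x => (hF x).dual) hγ hΓ hβ' hc' hβ h' h
      exact hno A hA hholds
    · obtain ⟨A, hA, hholds⟩ := exists_holds_of_cut ih hF hγ hΓ hβ hc hβ' h h'
      exact hno A hA hholds

end InfDeriv

end Calculus

/-! ### The exponentiation hierarchy and the cumulative hierarchy -/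

section Hierarchy

variable {M : Set ZFSet.{0}} {v : ℕ → ZFSet.{0}} {n : ℕ} {e : Fin n → ZFSet.{0}}
  {x y a b f X : ZFSet.{0}} {α β μ ξ : Ordinal.{0}}

@[simp] theorem Tm.eval_shift (v : ℕ → ZFSet.{0}) (x : ZFSet.{0}) (e : Fin n → ZFSet.{0})
    (t : Tm n) : t.shift.eval v (Fin.cons x e : Fin (n + 1) → ZFSet.{0}) = t.eval v e := by
  cases t <;> simp [shift, subst, eval]

@[simp] theorem Tm.eval_fv (v : ℕ → ZFSet.{0}) (e : Fin n → ZFSet.{0}) (i : ℕ) :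
    (fv i : Tm n).eval v e = v i := rfl

@[simp] theorem Tm.eval_bv (v : ℕ → ZFSet.{0}) (e : Fin n → ZFSet.{0}) (k : Fin n) :
    (bv k : Tm n).eval v e = e k := rfl

theorem sat_eqF (hM : ∀ x ∈ M, ∀ y ∈ x, y ∈ M) {s t : Tm n} (hs : s.eval v e ∈ M)
    (ht : t.eval v e ∈ M) : Sat M v e (eqF s t) ↔ s.eval v e = t.eval v e := by
  simp only [eqF, Sat, Tm.eval_bv, Tm.eval_shift, Fin.cons_zero]
  constructor
  · rintro ⟨hst, hts⟩
    ext z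
    exact ⟨fun hz => hst z (hM _ hs _ hz) hz, fun hz => hts z (hM _ ht _ hz) hz⟩
  · intro h
    rw [h]
    exact ⟨fun _ _ hx => hx, fun _ _ hx => hx⟩

theorem definableOver_of_mem (hM : ∀ x ∈ M, ∀ y ∈ x, y ∈ M) (hx : x ∈ M) : DefinableOver M x :=
  ⟨.mem (.bv 0) (.fv 0), fun _ => x, fun _ _ => hx,
    fun y => ⟨fun h => ⟨hM x hx y h, h⟩, fun h => h.2⟩⟩

theorem definableOver_pair (hM : ∀ x ∈ M, ∀ y ∈ x, y ∈ M) (hx : x ∈ M) (hy : y ∈ M) :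
    DefinableOver M {x, y} := by
  let v : ℕ → ZFSet.{0}
    | 0 => x
    | _ => y
  refine ⟨.or (eqF (.bv 0) (.fv 0)) (eqF (.bv 0) (.fv 1)), v, fun i _ => ?_, fun z => ?_⟩
  · cases i <;> assumption
  · have hsat (hz : z ∈ M) : Sat M v (fun _ => z)
        (.or (eqF (.bv 0) (.fv 0)) (eqF (.bv 0) (.fv 1)) : Fml 1) ↔ z = x ∨ z = y :=
      or_congr (sat_eqF hM hz hx) (sat_eqF hM hz hy)
    rw [ZFSet.mem_pair]
    refine ⟨fun h => ?_, fun h => (hsat h.1).1 h.2⟩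
    have hz : z ∈ M := by rcases h with rfl | rfl <;> assumption
    exact ⟨hz, (hsat hz).2 h⟩

theorem mem_EHier : X ∈ EHier α ↔
    (∃ β, ∃ _ : α = β + 1, DefinableOver (EHier β) X) ∨
    (∃ β, ∃ _ : α = β + 2, ∃ a ∈ EHier β, ∃ b ∈ EHier β, ZFSet.IsFunc a b X) ∨
    (Order.IsSuccLimit α ∧ ∃ β, ∃ _ : β < α, X ∈ EHier β) := by
  rw [EHier]; exact Iff.rfl

theorem DefinableOver.mem_EHier (h : DefinableOver (EHier β) X) : X ∈ EHier (β + 1) :=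
  IKPE.mem_EHier.2 (.inl ⟨β, rfl, h⟩)

theorem mem_EHier_of_isFunc (ha : a ∈ EHier β) (hb : b ∈ EHier β) (h : ZFSet.IsFunc a b f) :
    f ∈ EHier (β + 2) :=
  mem_EHier.2 (.inr (.inl ⟨β, rfl, a, ha, b, hb, h⟩))

theorem rank_pair_le (hx : x.rank < β) (hy : y.rank < β) : (ZFSet.pair x y).rank ≤ β + 1 := by
  simp only [ZFSet.pair, ZFSet.rank_pair, ZFSet.rank_singleton, Order.succ_eq_add_one]
  have hx' : x.rank + 1 ≤ β := Order.add_one_le_of_lt hx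
  have hy' : y.rank + 1 ≤ β := Order.add_one_le_of_lt hy
  exact max_le (add_le_add_left hx' 1) (add_le_add_left (max_le hx' hy') 1)

theorem rank_le_of_isFunc (h : ZFSet.IsFunc a b f) : f.rank ≤ max a.rank b.rank + 2 := by
  refine ZFSet.rank_le_iff.2 fun p hp => ?_
  obtain ⟨y, hy, z, hz, rfl⟩ := ZFSet.mem_prod.1 (h.1 hp)
  refine (rank_pair_le (lt_max_of_lt_left (ZFSet.rank_lt_of_mem hy))
    (lt_max_of_lt_right (ZFSet.rank_lt_of_mem hz))).trans_lt (add_lt_add_right one_lt_two _)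

theorem rank_lt_of_mem_EHier (hX : X ∈ EHier α) : X.rank < α := by
  induction α using WellFoundedLT.induction generalizing X with
  | _ α ih =>
    rcases mem_EHier.1 hX with ⟨β, rfl, F, v, -, h⟩ | ⟨β, rfl, a, ha, b, hb, h⟩ | ⟨-, β, hβ, h⟩
    · refine (ZFSet.rank_le_iff.2 fun y hy => ?_).trans_lt (lt_add_one β)
      exact ih β (lt_add_one β) ((h y).1 hy).1
    · have hβ : β < β + 2 := lt_add_of_pos_right β two_pos
      have hmax : max a.rank b.rank < β := max_lt (ih β hβ ha) (ih β hβ hb)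
      refine (rank_le_of_isFunc h).trans_lt ?_
      simp only [← one_add_one_eq_two, ← add_assoc]
      simpa only [Order.lt_add_one_iff, Order.add_one_le_iff] using hmax
    · exact (ih β hβ h).trans hβ

theorem pair_mem_EHier (ht : ∀ γ < β + 2, ∀ x ∈ EHier γ, ∀ y ∈ x, y ∈ EHier γ)
    (hx : x ∈ EHier β) (hy : y ∈ EHier β) : ZFSet.pair x y ∈ EHier (β + 2) := by
  have h2 : β + 1 + 1 = β + 2 := by rw [add_assoc, one_add_one_eq_two]
  have hpair {z : ZFSet.{0}} (hz : z ∈ EHier β) : {x, z} ∈ EHier (β + 1) :=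
    (definableOver_pair (ht β (lt_add_of_pos_right β two_pos)) hx hz).mem_EHier
  simpa [ZFSet.pair, h2] using
    (definableOver_pair (ht (β + 1) (h2 ▸ lt_add_one (β + 1))) (hpair hx) (hpair hy)).mem_EHier

theorem EHier_transitive (α : Ordinal.{0}) : ∀ x ∈ EHier α, ∀ y ∈ x, y ∈ EHier α := by
  induction α using WellFoundedLT.induction with
  | _ α ih =>
    intro X hX y hy
    rcases mem_EHier.1 hX with ⟨β, rfl, F, v, -, h⟩ | ⟨β, rfl, a, ha, b, hb, h⟩ | ⟨hl, β, hβ, h⟩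
    · exact (definableOver_of_mem (ih β (lt_add_one β)) ((h y).1 hy).1).mem_EHier
    · have hβ : β < β + 2 := lt_add_of_pos_right β two_pos
      obtain ⟨s, hs, t, ht, rfl⟩ := ZFSet.mem_prod.1 (h.1 hy)
      exact pair_mem_EHier ih (ih β hβ a ha s hs) (ih β hβ b hb t ht)
    · exact mem_EHier.2 (.inr (.inr ⟨hl, β, hβ, ih β hβ X h y hy⟩))

theorem EHier_mono (h : α ≤ β) : EHier α ⊆ EHier β := by
  intro x hx
  induction β using Ordinal.limitRecOn with
  | zero => rwa [← nonpos_iff_eq_zero.1 h]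
  | add_one β ih =>
    obtain h | rfl := h.lt_or_eq
    · exact (definableOver_of_mem (EHier_transitive β) (ih (Order.lt_add_one_iff.1 h))).mem_EHier
    · exact hx
  | limit β hl _ =>
    obtain h | rfl := h.lt_or_eq
    · exact mem_EHier.2 (.inr (.inr ⟨hl, α, h, hx⟩))
    · exact hx

theorem exists_mem_EHier_add_one (μ : Ordinal.{0}) :
    ∃ a ∈ EHier (μ + 1), ∀ x, x ∈ a ↔ x ∈ EHier μ := by
  have ha (x : ZFSet.{0}) : x ∈ ZFSet.sep (· ∈ EHier μ) (ZFSet.vonNeumann μ) ↔ x ∈ EHier μ := by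
    simpa only [ZFSet.mem_sep, ZFSet.mem_vonNeumann, and_iff_right_iff_imp]
      using rank_lt_of_mem_EHier
  refine ⟨_, DefinableOver.mem_EHier ⟨.imp (.mem (.bv 0) (.bv 0)) (.mem (.bv 0) (.bv 0)),
    fun _ => ∅, by simp [Fml.fvs, Tm.fvs], fun x => ?_⟩, ha⟩
  simp only [ha, Sat, imp_self, and_true]

/-- The function on `a` with value `a` on `X` and value `{a}` elsewhere, an encoding of the
characteristic function of `X`. -/
noncomputable def indicator (a X : ZFSet.{0}) : ZFSet.{0} :=
  ZFSet.sep (fun p => ∃ x ∈ a, ∃ c, p = ZFSet.pair x c ∧ (x ∈ X ∧ c = a ∨ x ∉ X ∧ c = {a}))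
    (ZFSet.prod a {a, {a}})

theorem mem_indicator {p : ZFSet.{0}} : p ∈ indicator a X ↔
    ∃ x ∈ a, ∃ c, p = ZFSet.pair x c ∧ (x ∈ X ∧ c = a ∨ x ∉ X ∧ c = {a}) := by
  rw [indicator, ZFSet.mem_sep, and_iff_right_iff_imp]
  rintro ⟨x, hx, c, rfl, h⟩
  simp only [ZFSet.pair_mem_prod, ZFSet.mem_pair]
  tauto

theorem isFunc_indicator (a X : ZFSet.{0}) : ZFSet.IsFunc a {a, {a}} (indicator a X) := by
  refine ⟨fun p hp => (ZFSet.mem_sep.1 hp).1, fun x hx => ?_⟩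
  simp only [mem_indicator, ZFSet.pair_inj]
  by_cases hxX : x ∈ X
  · exact ⟨a, ⟨x, hx, a, ⟨rfl, rfl⟩, .inl ⟨hxX, rfl⟩⟩, by rintro _ ⟨_, _, _, ⟨rfl, rfl⟩, h⟩; tauto⟩
  · exact ⟨{a}, ⟨x, hx, {a}, ⟨rfl, rfl⟩, .inr ⟨hxX, rfl⟩⟩,
      by rintro _ ⟨_, _, _, ⟨rfl, rfl⟩, h⟩; tauto⟩

theorem mem_iff_of_indicator (hX : X ⊆ a) : y ∈ X ↔
    ∃ p ∈ indicator a X, (∀ q ∈ p, y ∈ q) ∧ ∃ q ∈ p, a ∈ q := by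
  have hne : a ≠ {a} := fun h => ZFSet.mem_irrefl a (by simpa using ZFSet.ext_iff.1 h a)
  constructor
  · refine fun hy => ⟨_, mem_indicator.2 ⟨y, hX hy, a, rfl, .inl ⟨hy, rfl⟩⟩, ?_⟩
    simp [ZFSet.pair]
  · rintro ⟨p, hp, hy, ha⟩
    obtain ⟨x, hx, c, rfl, h⟩ := mem_indicator.1 hp
    simp only [ZFSet.pair, ZFSet.mem_pair, forall_eq_or_imp, forall_eq, exists_eq_or_imp,
      exists_eq_left, ZFSet.mem_singleton] at hy ha
    have hxa : a ≠ x := fun h => ZFSet.mem_irrefl x (h ▸ hx)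
    obtain ⟨hxX, -⟩ | ⟨-, rfl⟩ := h
    · rwa [hy.1]
    · tauto

theorem definableOver_of_indicator_mem (hM : ∀ x ∈ M, ∀ y ∈ x, y ∈ M) (ha : a ∈ M)
    (hf : indicator a X ∈ M) (hX : X ⊆ a) : DefinableOver M X := by
  let v : ℕ → ZFSet.{0}
    | 0 => indicator a X
    | _ => a
  refine ⟨.bex (.fv 0) (.and (.ball (.bv 0) (.mem (.bv 2) (.bv 0)))
    (.bex (.bv 0) (.mem (.fv 1) (.bv 0)))), v, fun i _ => ?_, fun y => ?_⟩
  · cases i <;> assumption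
  · rw [mem_iff_of_indicator hX]
    constructor
    · rintro ⟨p, hp, hy, q, hq, haq⟩
      have hp' := hM _ hf p hp
      refine ⟨hM _ ha y (hX ((mem_iff_of_indicator hX).2 ⟨p, hp, hy, q, hq, haq⟩)), p, hp', hp,
        fun q _ hq => hy q hq, q, hM _ hp' q hq, hq, haq⟩
    · rintro ⟨-, p, hp', hp, hy, q, -, hq, haq⟩
      exact ⟨p, hp, fun q hq => hy q (hM _ hp' q hq) hq, q, hq, haq⟩

theorem exists_mem_EHier_add_natCast (hX : ∀ y ∈ X, y ∈ EHier μ) :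
    ∃ n : ℕ, X ∈ EHier (μ + n) := by
  obtain ⟨a, ha, hmem⟩ := exists_mem_EHier_add_one μ
  have hle {i j : ℕ} (h : i ≤ j) : μ + i ≤ μ + j := by gcongr
  have ha (i : ℕ) (hi : 1 ≤ i) : a ∈ EHier (μ + i) :=
    EHier_mono (hle hi) (by rwa [Nat.cast_one])
  have hpair {x y : ZFSet.{0}} {i : ℕ} (hx : x ∈ EHier (μ + i)) (hy : y ∈ EHier (μ + i)) :
      {x, y} ∈ EHier (μ + (i + 1 : ℕ)) := by
    rw [Nat.cast_add_one, ← add_assoc]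
    exact (definableOver_pair (EHier_transitive _) hx hy).mem_EHier
  have hsing : {a} ∈ EHier (μ + (2 : ℕ)) := by
    simpa using hpair (ha 1 le_rfl) (ha 1 le_rfl)
  have hf : indicator a X ∈ EHier (μ + (5 : ℕ)) := by
    rw [show ((5 : ℕ) : Ordinal.{0}) = (3 : ℕ) + 2 by norm_num, ← add_assoc]
    exact mem_EHier_of_isFunc (ha 3 (by norm_num)) (hpair (ha 2 (by norm_num)) hsing)
      (isFunc_indicator a X)
  refine ⟨6, ?_⟩
  rw [show (6 : ℕ) = 5 + 1 from rfl, Nat.cast_add_one, ← add_assoc]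
  exact (definableOver_of_indicator_mem (EHier_transitive _) (ha 5 (by norm_num)) hf
    fun y hy => (hmem y).2 (hX y hy)).mem_EHier

theorem mem_EHier_rank (X : ZFSet.{0}) : X ∈ EHier (ω * (X.rank + 1)) := by
  induction X using ZFSet.inductionOn with
  | _ X ih =>
    have h : ∀ y ∈ X, y ∈ EHier (ω * X.rank) := fun y hy =>
      EHier_mono (mul_le_mul_right (Order.add_one_le_of_lt (ZFSet.rank_lt_of_mem hy)) ω) (ih y hy)
    obtain ⟨n, hn⟩ := exists_mem_EHier_add_natCast h
    refine EHier_mono ?_ hn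
    rw [mul_add_one]
    gcongr
    exact (natCast_lt_omega0 n).le

theorem IsCountableEpsilon.EHier_eq (hξ : IsCountableEpsilon ξ) : EHier ξ = {x | x.rank < ξ} := by
  ext x
  refine ⟨rank_lt_of_mem_EHier, fun hx => EHier_mono ?_ (mem_EHier_rank x)⟩
  calc ω * (x.rank + 1) ≤ ω ^ (1 : Ordinal.{0}) * ω ^ (x.rank + 1) := by
        rw [opow_one]; gcongr; exact right_le_opow _ one_lt_omega0
    _ = ω ^ (1 + (x.rank + 1)) := (opow_add _ _ _).symm
    _ ≤ ξ := (hξ.opow_lt (hξ.add_lt hξ.one_lt (hξ.add_one_lt hx))).le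

end Hierarchy

/-! ### Translation into infinitary formulas -/

namespace InfFml

variable {δ : Ordinal.{0}} {A B : InfFml} {k : ℕ}

open Classical in
/-- Binary conjunction, as a conjunction over all sets `x` that depends only on whether `x = ∅`. -/
noncomputable def and (A B : InfFml) : InfFml :=
  conj (some Set.univ) fun x => if x = ∅ then A else B

open Classical in
/-- Binary disjunction, encoded like `InfFml.and`. -/
noncomputable def or (A B : InfFml) : InfFml :=
  disj (some Set.univ) fun x => if x = ∅ then A else B

theorem singleton_empty_ne_empty : ({∅} : ZFSet.{0}) ≠ ∅ :=
  ne_of_mem_of_not_mem' (ZFSet.mem_singleton.2 rfl) (ZFSet.notMem_empty ∅)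

@[simp] theorem dual_and (A B : InfFml) : (and A B).dual = or A.dual B.dual := by
  simp only [and, or, dual, apply_ite dual]

@[simp] theorem dual_or (A B : InfFml) : (or A B).dual = and A.dual B.dual := by
  simp only [and, or, dual, apply_ite dual]

@[simp] theorem holds_or : (or A B).Holds δ ↔ A.Holds δ ∨ B.Holds δ := by
  simp only [or, Holds, range_some, Set.mem_univ, true_and]
  constructor
  · rintro ⟨x, h⟩
    split_ifs at h
    exacts [.inl h, .inr h]
  · rintro (h | h)
    · exact ⟨∅, by rwa [if_pos rfl]⟩
    · exact ⟨{∅}, by rwa [if_neg singleton_empty_ne_empty]⟩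

@[simp] theorem holds_and : (and A B).Holds δ ↔ A.Holds δ ∧ B.Holds δ := by
  rw [← dual_dual (and A B), holds_dual, dual_and, holds_or, holds_dual, holds_dual]
  tauto

theorem IsBdd.and (hA : A.IsBdd) (hB : B.IsBdd) : (A.and B).IsBdd :=
  .conj fun x => by split_ifs <;> assumption

theorem IsBdd.or (hA : A.IsBdd) (hB : B.IsBdd) : (A.or B).IsBdd :=
  .disj fun x => by split_ifs <;> assumption

theorem IsSig.and (hA : A.IsSig) (hB : B.IsSig) : (A.and B).IsSig :=
  .conj fun x => by split_ifs <;> assumption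

theorem IsSig.or (hA : A.IsSig) (hB : B.IsSig) : (A.or B).IsSig :=
  .disj fun x => by split_ifs <;> assumption

theorem RankLE.and (hA : RankLE k A) (hB : RankLE k B) : RankLE (k + 1) (A.and B) :=
  .conj fun x => by split_ifs <;> assumption

theorem RankLE.or (hA : RankLE k A) (hB : RankLE k B) : RankLE (k + 1) (A.or B) :=
  .disj fun x => by split_ifs <;> assumption

end InfFml

section Translation

variable {v : ℕ → ZFSet.{0}} {n m : ℕ} {e : Fin n → ZFSet.{0}} {x : ZFSet.{0}}
  {δ ξ : Ordinal.{0}} {A : Fml n}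

/-- The infinitary formula expressed by a formula when `v` interprets the free variables and `e` the
dangling bound variables. -/
noncomputable def Fml.toInf (v : ℕ → ZFSet.{0}) : {n : ℕ} → (Fin n → ZFSet.{0}) → Fml n → InfFml
  | _, e, .mem s t => .atom (s.eval v e ∈ t.eval v e)
  | _, e, .neg A => (A.toInf v e).dual
  | _, e, .and A B => (A.toInf v e).and (B.toInf v e)
  | _, e, .or A B => (A.toInf v e).or (B.toInf v e)
  | _, e, .imp A B => (A.toInf v e).dual.or (B.toInf v e)
  | _, e, .all F => .conj none fun x => F.toInf v (Fin.cons x e)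
  | _, e, .ex F => .disj none fun x => F.toInf v (Fin.cons x e)
  | _, e, .ball t F => .conj (some {x | x ∈ t.eval v e}) fun x => F.toInf v (Fin.cons x e)
  | _, e, .bex t F => .disj (some {x | x ∈ t.eval v e}) fun x => F.toInf v (Fin.cons x e)
  | _, e, .eall s t F =>
      .conj (some {x | ZFSet.IsFunc (s.eval v e) (t.eval v e) x}) fun x =>
        F.toInf v (Fin.cons x e)
  | _, e, .eex s t F =>
      .disj (some {x | ZFSet.IsFunc (s.eval v e) (t.eval v e) x}) fun x =>
        F.toInf v (Fin.cons x e)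

theorem Tm.eval_subst (e : Fin m → ZFSet.{0}) (σ : Fin n → Tm m) (t : Tm n) :
    (t.subst σ).eval v e = t.eval v fun k => (σ k).eval v e := by
  cases t <;> rfl

theorem eval_upSubst (e : Fin m → ZFSet.{0}) (σ : Fin n → Tm m) (x : ZFSet.{0}) :
    (fun k => (upSubst σ k).eval v (Fin.cons x e : Fin (m + 1) → ZFSet.{0})) =
      (Fin.cons x fun k => (σ k).eval v e : Fin (n + 1) → ZFSet.{0}) := by
  funext k
  refine Fin.cases rfl (fun k => ?_) k
  simp [upSubst]

theorem Fml.toInf_subst (e : Fin m → ZFSet.{0}) (σ : Fin n → Tm m) (A : Fml n) :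
    (A.subst σ).toInf v e = A.toInf v fun k => (σ k).eval v e := by
  induction A generalizing m <;>
    simp only [subst, toInf, Tm.eval_subst, eval_upSubst, *]

theorem Fml.isDelta0_subst (σ : Fin n → Tm m) (A : Fml n) :
    (A.subst σ).IsDelta0 ↔ A.IsDelta0 := by
  induction A generalizing m <;> simp [subst, IsDelta0, *]

theorem Tm.dependsOn_eval (t : Tm n) (e : Fin n → ZFSet.{0}) :
    DependsOn (fun v : ℕ → ZFSet.{0} => t.eval v e) t.fvs := by
  intro v v' h
  cases t with
  | fv i => exact h i (Finset.mem_singleton_self i)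
  | bv k => rfl

theorem Fml.dependsOn_toInf (A : Fml n) (e : Fin n → ZFSet.{0}) :
    DependsOn (fun v => A.toInf v e) A.fvs := by
  intro v v' h
  dsimp only
  induction A with
  | neg A ih | all F ih | ex F ih => simp only [toInf, ih _ h]
  | mem s t =>
    simp only [fvs, Finset.coe_union, Set.mem_union, or_imp, forall_and] at h
    simp only [toInf, Tm.dependsOn_eval s e h.1, Tm.dependsOn_eval t e h.2]
  | and A B ihA ihB | or A B ihA ihB | imp A B ihA ihB =>
    simp only [fvs, Finset.coe_union, Set.mem_union, or_imp, forall_and] at h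
    simp only [toInf, ihA _ h.1, ihB _ h.2]
  | ball t F ih | bex t F ih =>
    simp only [fvs, Finset.coe_union, Set.mem_union, or_imp, forall_and] at h
    simp only [toInf, ih _ h.2, Tm.dependsOn_eval t e h.1]
  | eall s t F ih | eex s t F ih =>
    simp only [fvs, Finset.coe_union, Set.mem_union, or_imp, forall_and] at h
    simp only [toInf, ih _ h.2, Tm.dependsOn_eval s e h.1.1, Tm.dependsOn_eval t e h.1.2]

theorem Fml.IsDelta0.isBdd_toInf (h : A.IsDelta0) : (A.toInf v e).IsBdd := by
  induction A with
  | mem s t => exact .atom _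
  | neg A ih => exact (ih h).dual
  | and A B ihA ihB => exact (ihA h.1).and (ihB h.2)
  | or A B ihA ihB => exact (ihA h.1).or (ihB h.2)
  | imp A B ihA ihB => exact (ihA h.1).dual.or (ihB h.2)
  | all | ex => exact h.elim
  | ball t F ih | eall s t F ih => exact .conj fun _ => ih h
  | bex t F ih | eex s t F ih => exact .disj fun _ => ih h

theorem InClass.isSig_toInf {p : Polarity} (h : InClass p A) (v : ℕ → ZFSet.{0})
    (e : Fin n → ZFSet.{0}) :
    match p with
    | .sigma => (A.toInf v e).IsSig
    | .pi => (A.toInf v e).dual.IsSig := by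
  induction h with
  | @delta0 p _ _ h => cases p <;> [exact h.isBdd_toInf.isSig; exact h.isBdd_toInf.dual.isSig]
  | @and p _ _ _ _ _ ih ih' =>
    cases p
    · exact (ih e).and (ih' e)
    · simpa [Fml.toInf] using (ih e).or (ih' e)
  | @or p _ _ _ _ _ ih ih' =>
    cases p
    · exact (ih e).or (ih' e)
    · simpa [Fml.toInf] using (ih e).and (ih' e)
  | @ball p _ _ _ _ ih | @eall p _ _ _ _ _ ih =>
    cases p <;> [exact .conj fun _ => ih _; exact .disj fun _ => ih _]
  | @bex p _ _ _ _ ih | @eex p _ _ _ _ _ ih =>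
    cases p <;> [exact .disj fun _ => ih _; exact .conj fun _ => ih _]
  | ex _ ih | all _ ih => exact .disj fun _ => ih _
  | @neg p _ _ _ ih =>
    cases p
    · exact ih e
    · simpa [Fml.toInf, Polarity.dual] using ih e
  | @imp p _ _ _ _ _ ih ih' =>
    cases p
    · exact IsSig.or (ih e) (ih' e)
    · simpa [Fml.toInf, Polarity.dual] using IsSig.and (ih e) (ih' e)

theorem lt_seqCode {l : List ℕ} {a : ℕ} (h : a ∈ l) : a < seqCode l := by
  induction l with
  | nil => cases h
  | cons b l ih =>
    change a < Nat.pair b (seqCode l) + 1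
    obtain rfl | h := List.mem_cons.1 h
    · exact Nat.lt_succ_of_le (Nat.left_le_pair _ _)
    · exact (ih h).trans_le ((Nat.right_le_pair _ _).trans (Nat.le_succ _))

theorem Fml.rankLE_toInf (v : ℕ → ZFSet.{0}) (e : Fin n → ZFSet.{0}) (A : Fml n) :
    RankLE A.code (A.toInf v e) := by
  induction A with
  | mem => exact (IsBdd.atom _).rankLE_zero.mono (Nat.zero_le _)
  | neg A ih => exact (ih e).dual.mono (lt_seqCode (by simp)).le
  | and A B ihA ihB =>
    exact (((ihA e).mono (le_max_left _ _)).and ((ihB e).mono (le_max_right _ _))).mono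
      (max_lt (lt_seqCode (by simp)) (lt_seqCode (by simp)))
  | or A B ihA ihB =>
    exact (((ihA e).mono (le_max_left _ _)).or ((ihB e).mono (le_max_right _ _))).mono
      (max_lt (lt_seqCode (by simp)) (lt_seqCode (by simp)))
  | imp A B ihA ihB =>
    exact (((ihA e).dual.mono (le_max_left _ _)).or ((ihB e).mono (le_max_right _ _))).mono
      (max_lt (lt_seqCode (by simp)) (lt_seqCode (by simp)))
  | all F ih | ball t F ih | eall s t F ih =>
    exact RankLE.mono (lt_seqCode (by simp)) (RankLE.conj fun x => ih (Fin.cons x e))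
  | ex F ih | bex t F ih | eex s t F ih =>
    exact RankLE.mono (lt_seqCode (by simp)) (RankLE.disj fun x => ih (Fin.cons x e))

theorem Fml.toInf_app (F : Fml 1) (t : Tm n) :
    (F.app t).toInf v e = F.toInf v (Fin.cons (t.eval v e) Fin.elim0) := by
  rw [app, toInf_subst]
  congr! with i
  exact Fin.cases rfl (fun k => k.elim0) i

theorem Fml.toInf_app₂ (G : Fml 2) (s t : Tm n) :
    (G.app₂ s t).toInf v e = G.toInf v ![t.eval v e, s.eval v e] := by
  rw [app₂, toInf_subst]
  congr! with i
  fin_cases i <;> rfl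

@[simp] theorem holds_toInf_eqF (s t : Tm n) :
    ((eqF s t).toInf v e).Holds δ ↔ s.eval v e = t.eval v e := by
  simp only [eqF, Fml.toInf, holds_and, Holds, range_some, Set.mem_ofPred_eq, Tm.eval_bv,
    Tm.eval_shift, Fin.cons_zero]
  exact ⟨fun h => ZFSet.ext fun z => ⟨h.1 z, h.2 z⟩, fun h => by simp [h]⟩

@[simp] theorem holds_toInf_upairF (u y z : Tm n) :
    ((upairF u y z).toInf v e).Holds δ ↔ u.eval v e = {y.eval v e, z.eval v e} := by
  simp only [upairF, Fml.toInf, holds_and, holds_or, Holds, range_some, Set.mem_ofPred_eq,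
    holds_toInf_eqF, Tm.eval_bv, Tm.eval_shift, Fin.cons_zero, ZFSet.ext_iff, ZFSet.mem_pair]
  simp only [← ZFSet.ext_iff]
  refine ⟨fun ⟨hy, hz, h⟩ w => ⟨h w, ?_⟩, fun h => ⟨(h _).2 (.inl rfl), (h _).2 (.inr rfl),
    fun w => (h w).1⟩⟩
  rintro (rfl | rfl) <;> assumption

@[simp] theorem holds_toInf_opairF (w y z : Tm n) :
    ((opairF w y z).toInf v e).Holds δ ↔ w.eval v e = ZFSet.pair (y.eval v e) (z.eval v e) := by
  simp only [opairF, Fml.toInf, holds_and, holds_or, Holds, range_some, Set.mem_ofPred_eq,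
    holds_toInf_eqF, holds_toInf_upairF, Tm.eval_bv, Tm.eval_shift,
    Fin.cons_zero, ZFSet.pair, ZFSet.pair_eq_singleton]
  constructor
  · rintro ⟨_, hu, _, hu', rfl, rfl, h⟩
    ext r
    rw [ZFSet.mem_pair, or_comm]
    refine ⟨h r, ?_⟩
    rintro (rfl | rfl) <;> assumption
  · intro h
    simp only [h, ZFSet.mem_pair]
    exact ⟨_, .inr rfl, _, .inl rfl, rfl, rfl, fun r => Or.symm⟩

@[simp] theorem holds_toInf_opairMemF (y z x : Tm n) :
    ((opairMemF y z x).toInf v e).Holds δ ↔ ZFSet.pair (y.eval v e) (z.eval v e) ∈ x.eval v e := by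
  simp [opairMemF, Fml.toInf, Holds]

@[simp] theorem holds_toInf_funF (x a b : Tm n) :
    ((funF x a b).toInf v e).Holds δ ↔ ZFSet.IsFunc (a.eval v e) (b.eval v e) (x.eval v e) := by
  simp only [funF, Fml.toInf, holds_and, holds_or, holds_dual, Holds, range_some,
    Set.mem_ofPred_eq, holds_toInf_eqF, holds_toInf_opairF, holds_toInf_opairMemF, Tm.eval_bv,
    Tm.eval_shift, Fin.cons_zero, ← imp_iff_not_or]
  constructor
  · rintro ⟨hsub, hex, huniq⟩
    have hsub : x.eval v e ⊆ ZFSet.prod (a.eval v e) (b.eval v e) := fun p hp =>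
      ZFSet.mem_prod.2 (hsub p hp)
    refine ⟨hsub, fun y hy => ?_⟩
    obtain ⟨z, hz, hyz⟩ := hex y hy
    exact ⟨z, hyz, fun w hyw =>
      huniq y hy w (ZFSet.pair_mem_prod.1 (hsub hyw)).2 z hz ⟨hyw, hyz⟩⟩
  · rintro ⟨hsub, hfun⟩
    refine ⟨fun p hp => ZFSet.mem_prod.1 (hsub hp), fun y hy => ?_, fun y hy z _ w _ h =>
      (hfun y hy).unique h.1 h.2⟩
    obtain ⟨z, hyz, -⟩ := hfun y hy
    exact ⟨z, (ZFSet.pair_mem_prod.1 (hsub hyz)).2, hyz⟩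

theorem isDelta0_funF (x a b : Tm n) : (funF x a b).IsDelta0 := by
  simp [funF, opairMemF, opairF, upairF, eqF, Fml.IsDelta0]

theorem Tm.rank_eval_lt (hv : ∀ i, (v i).rank < ξ) (he : ∀ i, (e i).rank < ξ) (t : Tm n) :
    (t.eval v e).rank < ξ := by
  cases t with
  | fv i => exact hv i
  | bv k => exact he k

theorem rank_cons_lt (he : ∀ i, (e i).rank < ξ) (hx : x.rank < ξ) (i : Fin (n + 1)) :
    ((Fin.cons x e : Fin (n + 1) → ZFSet.{0}) i).rank < ξ :=
  Fin.cases hx he i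

theorem IsCountableEpsilon.rank_lt_of_isFunc (hξ : IsCountableEpsilon ξ) {a b : ZFSet.{0}}
    (ha : a.rank < ξ) (hb : b.rank < ξ) (h : ZFSet.IsFunc a b x) : x.rank < ξ :=
  (rank_le_of_isFunc h).trans_lt (hξ.add_lt (max_lt ha hb) (mod_cast hξ.natCast_lt 2))

theorem Fml.holds_toInf_iff (hξ : IsCountableEpsilon ξ) (hv : ∀ i, (v i).rank < ξ)
    (he : ∀ i, (e i).rank < ξ) (A : Fml n) :
    (A.toInf v e).Holds ξ ↔ Sat {x | x.rank < ξ} v e A := by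
  have forall_iff {S : Set ZFSet.{0}} {P Q : ZFSet.{0} → Prop} (hS : ∀ x ∈ S, x.rank < ξ)
      (h : ∀ x, x.rank < ξ → (P x ↔ Q x)) :
      (∀ x ∈ S, P x) ↔ ∀ x ∈ {x : ZFSet.{0} | x.rank < ξ}, x ∈ S → Q x :=
    forall_congr' fun x => ⟨fun hP hx hxS => (h x hx).1 (hP hxS),
      fun hQ hxS => (h x (hS x hxS)).2 (hQ (hS x hxS) hxS)⟩
  have exists_iff {S : Set ZFSet.{0}} {P Q : ZFSet.{0} → Prop} (hS : ∀ x ∈ S, x.rank < ξ)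
      (h : ∀ x, x.rank < ξ → (P x ↔ Q x)) :
      (∃ x ∈ S, P x) ↔ ∃ x ∈ {x : ZFSet.{0} | x.rank < ξ}, x ∈ S ∧ Q x :=
    exists_congr fun x => ⟨fun hP => ⟨hS x hP.1, hP.1, (h x (hS x hP.1)).1 hP.2⟩,
      fun hQ => ⟨hQ.2.1, (h x hQ.1).2 hQ.2.2⟩⟩
  induction A with
  | mem s t => rfl
  | neg A ih => simp [toInf, Sat, ih he]
  | and A B ihA ihB => simp [toInf, Sat, ihA he, ihB he]
  | or A B ihA ihB => simp [toInf, Sat, ihA he, ihB he]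
  | imp A B ihA ihB => simp [toInf, Sat, ihA he, ihB he, imp_iff_not_or]
  | all F ih => exact forall₂_congr fun x hx => ih (rank_cons_lt he hx)
  | ex F ih => exact exists_congr fun x => and_congr_right fun hx => ih (rank_cons_lt he hx)
  | ball t F ih =>
    exact forall_iff (fun x hx => (ZFSet.rank_lt_of_mem hx).trans (t.rank_eval_lt hv he))
      fun x hx => ih (rank_cons_lt he hx)
  | bex t F ih =>
    exact exists_iff (fun x hx => (ZFSet.rank_lt_of_mem hx).trans (t.rank_eval_lt hv he))
      fun x hx => ih (rank_cons_lt he hx)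
  | eall s t F ih =>
    exact forall_iff
      (fun x => hξ.rank_lt_of_isFunc (s.rank_eval_lt hv he) (t.rank_eval_lt hv he))
      fun x hx => ih (rank_cons_lt he hx)
  | eex s t F ih =>
    exact exists_iff
      (fun x => hξ.rank_lt_of_isFunc (s.rank_eval_lt hv he) (t.rank_eval_lt hv he))
      fun x hx => ih (rank_cons_lt he hx)

end Translation

/-! ### Derived rules -/

section DerivedRules

variable {ξ α β : Ordinal.{0}} {Γ : Set InfFml} {o : Option (Set ZFSet.{0})}
  {F : ZFSet.{0} → InfFml} {A B : InfFml} {k l : ℕ}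

theorem IsCountableEpsilon.control_natCast (hξ : IsCountableEpsilon ξ) (n : ℕ) : Control ξ n :=
  .base (hξ.natCast_lt n)

namespace InfDeriv

theorem excluded_middle_disj {n : ℕ}
    (hF : ∀ ξ' ≥ ξ, IsCountableEpsilon ξ' → ∀ x, ∀ Γ' : Set InfFml, F x ∈ Γ' → (F x).dual ∈ Γ' →
      InfDeriv k ξ' n Γ')
    (hmem : InfFml.disj o F ∈ Γ) (hmem' : (InfFml.disj o F).dual ∈ Γ) :
    InfDeriv k ξ (n + 2 : ℕ) Γ := by
  refine .conj (fun _ _ => (n + 1 : ℕ)) hmem' (fun _ _ _ _ _ => by simp) fun η hη hε x hx => ?_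
  refine .disj hx (Set.mem_insert_of_mem _ hmem) (by simp) (hε.control_natCast n) ?_
  exact hF η hη hε x _ (Set.mem_insert _ _) (Set.mem_insert_of_mem _ (Set.mem_insert _ _))

theorem excluded_middle (hA : RankLE l A) (hmem : A ∈ Γ) (hmem' : A.dual ∈ Γ) :
    InfDeriv k ξ (2 * l + 2 : ℕ) Γ := by
  have of_isBdd {ξ α : Ordinal.{0}} {A : InfFml} {Γ : Set InfFml} (hA : A.IsBdd)
      (hmem : A ∈ Γ) (hmem' : A.dual ∈ Γ) : InfDeriv k ξ α Γ := by
    by_cases h : A.Holds ξ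
    · exact .ax hA h hmem
    · exact .ax hA.dual (holds_dual.2 h) hmem'
  have of_subformulas {n : ℕ} {ξ : Ordinal.{0}} {Γ : Set InfFml} {A : InfFml} {o F}
      (hF : ∀ ξ' ≥ ξ, ∀ x, ∀ Γ' : Set InfFml, F x ∈ Γ' → (F x).dual ∈ Γ' → InfDeriv k ξ' n Γ')
      (hA : A = .conj o F ∨ A = .disj o F) (hmem : A ∈ Γ) (hmem' : A.dual ∈ Γ) :
      InfDeriv k ξ (n + 2 : ℕ) Γ := by
    obtain rfl | rfl := hA
    · exact excluded_middle_disj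
        (fun η hη _ x Γ' h h' => hF η hη x Γ' (by simpa only [dual_dual] using h') h)
        hmem' (by simpa only [InfFml.dual, dual_dual] using hmem)
    · exact excluded_middle_disj (fun η hη _ => hF η hη) hmem hmem'
  induction l generalizing A ξ Γ with
  | zero =>
    obtain hA | ⟨F, hF, hA⟩ := hA
    · exact of_isBdd hA hmem hmem'
    · exact of_subformulas (n := 0) (fun _ _ x _ h h' => of_isBdd (hF x) h h') hA hmem hmem'
  | succ l ih =>
    obtain hA | ⟨o, F, hF, hA⟩ := hA
    · exact (ih hA hmem hmem').mono_height (Nat.cast_le.2 (by omega))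
    · exact of_subformulas (fun _ _ x _ h h' => ih (hF x) h h') hA hmem hmem'

theorem and_intro (hmem : A.and B ∈ Γ) (hβ : β < α) (h : InfDeriv k ξ β (insert A Γ))
    (h' : InfDeriv k ξ β (insert B Γ)) : InfDeriv k ξ α Γ := by
  refine .conj (fun _ _ => β) hmem (fun _ _ _ _ _ => hβ) fun η hη _ x _ => ?_
  split_ifs
  exacts [h.mono_stage hη, h'.mono_stage hη]

theorem or_intro_left (hmem : A.or B ∈ Γ) (hβ : β < α) (hc : Control ξ β)
    (h : InfDeriv k ξ β (insert A Γ)) : InfDeriv k ξ α Γ :=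
  .disj (x := ∅) (Set.mem_univ _) hmem hβ hc (by rwa [if_pos rfl])

theorem or_intro_right (hmem : A.or B ∈ Γ) (hβ : β < α) (hc : Control ξ β)
    (h : InfDeriv k ξ β (insert B Γ)) : InfDeriv k ξ α Γ :=
  .disj (x := {∅}) (Set.mem_univ _) hmem hβ hc (by rwa [if_neg singleton_empty_ne_empty])

theorem and_left (hξ : IsCountableEpsilon ξ) (h : InfDeriv k ξ α (insert (A.and B) Γ)) :
    InfDeriv k ξ α (insert A Γ) := by
  simpa using h.inv_conj hξ (x := ∅) trivial

theorem and_right (hξ : IsCountableEpsilon ξ) (h : InfDeriv k ξ α (insert (A.and B) Γ)) :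
    InfDeriv k ξ α (insert B Γ) := by
  simpa [singleton_empty_ne_empty] using h.inv_conj hξ (x := {∅}) trivial

theorem inv_or (hξ : IsCountableEpsilon ξ) (h : InfDeriv k ξ α (insert (A.or B) Γ)) :
    InfDeriv k ξ α (insert A (insert B Γ)) := by
  refine (h.inv_disj hξ).mono (Set.union_subset ?_ fun C hC => .inr (.inr hC))
  rintro _ ⟨x, -, rfl⟩
  beta_reduce
  split_ifs
  exacts [.inl rfl, .inr (.inl rfl)]

theorem drop_of_not_holds (hA : A.IsBdd) (hholds : ¬ A.Holds ξ) (hβ : β < α) (hc : Control ξ β)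
    (h : InfDeriv k ξ β (insert A Γ)) : InfDeriv k ξ α Γ :=
  .cut (hA.rankLE_zero.mono (Nat.zero_le k)) hβ hc hβ hc h
    (.ax hA.dual (holds_dual.2 hholds) (Set.mem_insert _ _))

theorem set_induction {n : ℕ} (hF : ∀ x, RankLE n (F x)) (s : ZFSet.{0})
    (hξ : IsCountableEpsilon ξ) (hs : s.rank < ξ)
    (hprog : InfFml.disj none (fun u => .and (.conj (some {x | x ∈ u}) F) (F u).dual) ∈ Γ)
    (hmem : F s ∈ Γ) : InfDeriv k ξ (ω ^ (s.rank + 1)) Γ := by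
  induction s using ZFSet.inductionOn generalizing ξ Γ with
  | _ s ih =>
    have hlt (m : ℕ) : ω ^ s.rank + m < ω ^ (s.rank + 1) :=
      isPrincipal_add_omega0_opow _ (omega0_opow_lt_opow (lt_add_one _))
        ((natCast_lt_omega0 m).trans_le
          (left_le_opow ω (zero_le.trans_lt (lt_add_one s.rank))))
    refine .disj hs hprog (hlt (2 * n + 3))
      (.base ((hlt _).trans (hξ.opow_lt (hξ.add_one_lt hs)))) ?_
    refine and_intro (Set.mem_insert _ _) (β := ω ^ s.rank + (2 * n + 2 : ℕ)) (by gcongr; simp) ?_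
      ((excluded_middle (hF s) (by simp [hmem]) (by simp)).mono_height le_add_self)
    refine .conj (fun _ x => ω ^ (x.rank + 1)) (Set.mem_insert _ _) (fun _ _ _ x hx => ?_)
      fun η hη hε x hx => ?_
    · refine (opow_le_opow_right omega0_pos
        (Order.add_one_le_of_lt (ZFSet.rank_lt_of_mem hx))).trans_lt ?_
      exact lt_add_of_pos_right _ (mod_cast Nat.succ_pos _)
    · exact ih x hx hε ((ZFSet.rank_lt_of_mem hx).trans (hs.trans_le hη)) (.inr (.inr (.inr hprog)))
        (Set.mem_insert _ _)

end InfDeriv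

end DerivedRules

/-! ### Uniformly derivable families of sequents -/

section UniformlyDerivable

/-- Derivability of all the sequents `Γ v`, at every stage that is a countable epsilon number and
exceeds the ranks of the values of `v`, with a height `Ω + m` that depends neither on the stage nor
on `v`. -/
def UniformlyDerivable (k : ℕ) (Γ : (ℕ → ZFSet.{0}) → Set InfFml) : Prop :=
  ∃ m : ℕ, ∀ ξ v, IsCountableEpsilon ξ → (∀ i, (v i).rank < ξ) → InfDeriv k ξ (Om + m) (Γ v)

variable {ξ : Ordinal.{0}} {k c : ℕ} {Γ Γ' : (ℕ → ZFSet.{0}) → Set InfFml}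
  {A B G : (ℕ → ZFSet.{0}) → InfFml} {S : (ℕ → ZFSet.{0}) → Set ZFSet.{0}}
  {F : (ℕ → ZFSet.{0}) → ZFSet.{0} → InfFml}

theorem IsCountableEpsilon.control_Om_add_natCast (hξ : IsCountableEpsilon ξ) (m : ℕ) :
    Control ξ (Om + m) :=
  .add .Omega (hξ.control_natCast m)

theorem Om_add_natCast_lt (m : ℕ) : Om + m < Om + (m + 1 : ℕ) := by
  gcongr
  exact m.lt_succ_self

theorem Om_add_natCast_mono {m n : ℕ} (h : m ≤ n) : Om + m ≤ Om + n := by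
  gcongr

/-- The bounded formula `G v` says that the value of the variable `c` belongs to the set `S v`. -/
structure IsGuard (c : ℕ) (G : (ℕ → ZFSet.{0}) → InfFml) (S : (ℕ → ZFSet.{0}) → Set ZFSet.{0}) :
    Prop where
  isBdd : ∀ v, (G v).IsBdd
  holds_iff : ∀ v δ, (G v).Holds δ ↔ v c ∈ S v
  rank_lt : ∀ ξ v, IsCountableEpsilon ξ → (∀ i, (v i).rank < ξ) → ∀ x ∈ S v, x.rank < ξ

namespace UniformlyDerivable

theorem mono (h : UniformlyDerivable k Γ) (hΓ : ∀ v, Γ v ⊆ Γ' v) : UniformlyDerivable k Γ' :=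
  let ⟨m, h⟩ := h
  ⟨m, fun ξ v hξ hv => (h ξ v hξ hv).mono (hΓ v)⟩

theorem and (hmem : ∀ v, (A v).and (B v) ∈ Γ v)
    (h : UniformlyDerivable k fun v => insert (A v) (Γ v))
    (h' : UniformlyDerivable k fun v => insert (B v) (Γ v)) : UniformlyDerivable k Γ := by
  obtain ⟨m, h⟩ := h
  obtain ⟨m', h'⟩ := h'
  refine ⟨max m m' + 1, fun ξ v hξ hv => .and_intro (hmem v) (Om_add_natCast_lt _) ?_ ?_⟩
  · exact (h ξ v hξ hv).mono_height (Om_add_natCast_mono (le_max_left m m'))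
  · exact (h' ξ v hξ hv).mono_height (Om_add_natCast_mono (le_max_right m m'))

theorem or_left (hmem : ∀ v, (A v).or (B v) ∈ Γ v)
    (h : UniformlyDerivable k fun v => insert (A v) (Γ v)) : UniformlyDerivable k Γ :=
  let ⟨m, h⟩ := h
  ⟨m + 1, fun ξ v hξ hv =>
    .or_intro_left (hmem v) (Om_add_natCast_lt m) (hξ.control_Om_add_natCast m) (h ξ v hξ hv)⟩

theorem or_right (hmem : ∀ v, (A v).or (B v) ∈ Γ v)
    (h : UniformlyDerivable k fun v => insert (B v) (Γ v)) : UniformlyDerivable k Γ :=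
  let ⟨m, h⟩ := h
  ⟨m + 1, fun ξ v hξ hv =>
    .or_intro_right (hmem v) (Om_add_natCast_lt m) (hξ.control_Om_add_natCast m) (h ξ v hξ hv)⟩

theorem or (hmem : ∀ v, (A v).or (B v) ∈ Γ v)
    (h : UniformlyDerivable k fun v => insert (A v) (insert (B v) (Γ v))) :
    UniformlyDerivable k Γ :=
  .or_right hmem (.or_left (fun v => .inr (hmem v)) h)

theorem conj (hΓ : DependsOn Γ {c}ᶜ)
    (hF : DependsOn (fun v => InfFml.conj none (F v)) {c}ᶜ)
    (hmem : ∀ v, InfFml.conj none (F v) ∈ Γ v)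
    (h : UniformlyDerivable k fun v => insert (F v (v c)) (Γ v)) : UniformlyDerivable k Γ := by
  obtain ⟨m, h⟩ := h
  refine ⟨m + 1, fun ξ v _ hv => .conj (fun _ _ => Om + m) (hmem v)
    (fun _ _ _ _ _ => Om_add_natCast_lt m) fun η hη hε x hx => ?_⟩
  have hvx : ∀ i ∈ ({c}ᶜ : Set ℕ), Function.update v c x i = v i :=
    fun i hi => Function.update_of_ne hi x v
  have := h η (Function.update v c x) hε (Function.forall_update_iff v (p := fun _ y => y.rank < η)
    |>.2 ⟨hx, fun i _ => (hv i).trans_le hη⟩)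
  beta_reduce at this
  rwa [hΓ hvx, (InfFml.conj.inj (hF hvx)).2, Function.update_self] at this

theorem disj (hmem : ∀ v, InfFml.disj none (F v) ∈ Γ v)
    (h : UniformlyDerivable k fun v => insert (F v (v c)) (Γ v)) : UniformlyDerivable k Γ :=
  let ⟨m, h⟩ := h
  ⟨m + 1, fun ξ v hξ hv => .disj (hv c) (hmem v) (Om_add_natCast_lt m)
    (hξ.control_Om_add_natCast m) (h ξ v hξ hv)⟩

theorem guarded_conj (hG : IsGuard c G S) (hΓ : DependsOn Γ {c}ᶜ)
    (hF : DependsOn (fun v => InfFml.conj (some (S v)) (F v)) {c}ᶜ)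
    (hmem : ∀ v, InfFml.conj (some (S v)) (F v) ∈ Γ v)
    (h : UniformlyDerivable k fun v => insert ((G v).dual.or (F v (v c))) (Γ v)) :
    UniformlyDerivable k Γ := by
  obtain ⟨m, h⟩ := h
  refine ⟨m + 2, fun ξ v _ hv => .conj (fun _ _ => Om + (m + 1 : ℕ)) (hmem v)
    (fun _ _ _ _ _ => Om_add_natCast_lt (m + 1)) fun η hη hε x hx => ?_⟩
  have hvx : ∀ i ∈ ({c}ᶜ : Set ℕ), Function.update v c x i = v i :=
    fun i hi => Function.update_of_ne hi x v
  have hrank := hG.rank_lt η v hε (fun i => (hv i).trans_le hη) x hx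
  have hd := h η (Function.update v c x) hε (Function.forall_update_iff v
    (p := fun _ y => y.rank < η) |>.2 ⟨hrank, fun i _ => (hv i).trans_le hη⟩)
  obtain ⟨hS, hF⟩ := InfFml.conj.inj (hF hvx)
  have hguard : (G (Function.update v c x)).Holds η := by
    rwa [hG.holds_iff, Option.some.inj hS, Function.update_self]
  beta_reduce at hd
  rw [hΓ hvx, hF, Function.update_self] at hd
  exact (hd.inv_or hε).drop_of_not_holds (hG.isBdd _).dual (by rwa [holds_dual, not_not])
    (Om_add_natCast_lt m) (hε.control_Om_add_natCast m)

theorem guarded_disj (hG : IsGuard c G S) (hmem : ∀ v, InfFml.disj (some (S v)) (F v) ∈ Γ v)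
    (h : UniformlyDerivable k fun v => insert ((G v).and (F v (v c))) (Γ v)) :
    UniformlyDerivable k Γ := by
  obtain ⟨m, h⟩ := h
  refine ⟨m + 1, fun ξ v hξ hv => ?_⟩
  by_cases hc : v c ∈ S v
  · exact .disj hc (hmem v) (Om_add_natCast_lt m) (hξ.control_Om_add_natCast m)
      ((h ξ v hξ hv).and_right hξ)
  · exact ((h ξ v hξ hv).and_left hξ).drop_of_not_holds (hG.isBdd v)
      (mt (hG.holds_iff v ξ).1 hc) (Om_add_natCast_lt m) (hξ.control_Om_add_natCast m)

theorem cut (hA : ∀ v, RankLE k (A v)) (h : UniformlyDerivable k fun v => insert (A v) (Γ v))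
    (h' : UniformlyDerivable k fun v => insert (A v).dual (Γ v)) : UniformlyDerivable k Γ := by
  obtain ⟨m, h⟩ := h
  obtain ⟨m', h'⟩ := h'
  have hlt {n : ℕ} (hn : n ≤ max m m') : Om + n < Om + (max m m' + 1 : ℕ) :=
    (Om_add_natCast_mono hn).trans_lt (Om_add_natCast_lt _)
  exact ⟨max m m' + 1, fun ξ v hξ hv => .cut (hA v)
    (hlt (le_max_left m m')) (hξ.control_Om_add_natCast m)
    (hlt (le_max_right m m')) (hξ.control_Om_add_natCast m') (h ξ v hξ hv) (h' ξ v hξ hv)⟩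

theorem of_holds (hmem : ∀ v, A v ∈ Γ v) (hA : ∀ v, (A v).IsBdd)
    (h : ∀ ξ v, IsCountableEpsilon ξ → (∀ i, (v i).rank < ξ) → (A v).Holds ξ) :
    UniformlyDerivable k Γ :=
  ⟨0, fun ξ v hξ hv => .ax (hA v) (h ξ v hξ hv) (hmem v)⟩

theorem of_exists_holds (hmem : ∀ v, InfFml.disj none (F v) ∈ Γ v) (hF : ∀ v x, (F v x).IsBdd)
    (h : ∀ ξ v, IsCountableEpsilon ξ → (∀ i, (v i).rank < ξ) →
      ∃ x : ZFSet.{0}, x.rank < ξ ∧ (F v x).Holds ξ) : UniformlyDerivable k Γ := by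
  refine ⟨1, fun ξ v hξ hv => ?_⟩
  obtain ⟨x, hx, hholds⟩ := h ξ v hξ hv
  exact .disj hx (hmem v) (Om_add_natCast_lt 0) (hξ.control_Om_add_natCast 0)
    (.ax (hF v x) hholds (Set.mem_insert _ _))

theorem excluded_middle {l : ℕ} (hA : ∀ v, RankLE l (A v)) (hmem : ∀ v, A v ∈ Γ v)
    (hmem' : ∀ v, (A v).dual ∈ Γ v) : UniformlyDerivable k Γ :=
  ⟨2 * l + 2, fun _ v _ _ =>
    (InfDeriv.excluded_middle (hA v) (hmem v) (hmem' v)).mono_height le_add_self⟩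

theorem collection {B : (ℕ → ZFSet.{0}) → ZFSet.{0} → ZFSet.{0} → InfFml}
    (hB : ∀ v x y, (B v x y).IsBdd)
    (hmem : ∀ v, InfFml.disj none
      (fun z => .conj (some (S v)) fun x => .disj (some {y | y ∈ z}) (B v x)) ∈ Γ v)
    (hmem' : ∀ v, (InfFml.conj (some (S v)) fun x => .disj none (B v x)).dual ∈ Γ v) :
    UniformlyDerivable k Γ := by
  have hrank (v) : RankLE 1 (InfFml.conj (some (S v)) fun x => .disj none (B v x)) :=
    .conj fun x => .inr ⟨_, hB v x, .inr rfl⟩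
  obtain ⟨m, h⟩ := excluded_middle (k := k) (l := 1) hrank (fun v => Set.mem_insert _ (Γ v))
    fun v => .inr (hmem' v)
  exact ⟨m + 1, fun ξ v hξ hv => .coll (hB v) (hmem v) (Om_add_natCast_lt m)
    (hξ.control_Om_add_natCast m) (h ξ v hξ hv)⟩

theorem set_induction {n : ℕ} (hF : ∀ v x, RankLE n (F v x))
    (hprog : ∀ v, InfFml.disj none
      (fun u => .and (.conj (some {x | x ∈ u}) (F v)) (F v u).dual) ∈ Γ v)
    (hmem : ∀ v, InfFml.conj none (F v) ∈ Γ v) : UniformlyDerivable k Γ := by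
  refine ⟨0, fun _ v _ _ => .conj (fun _ x => ω ^ (x.rank + 1)) (hmem v) (fun η _ hε x hx => ?_)
    fun η _ hε x hx => .set_induction (hF v) x hε hx (.inr (hprog v)) (Set.mem_insert _ _)⟩
  exact ((hε.opow_lt (hε.add_one_lt hx)).trans hε.lt_Om).trans_le le_self_add

end UniformlyDerivable

end UniformlyDerivable

/-! ### Embedding of the finite calculus -/

section Embedding

variable {k c : ℕ} {v : ℕ → ZFSet.{0}} {Γ : Finset Formula} {Δ : Option Formula}
  {A B G Q : Formula} {F : Fml 1} {S : (ℕ → ZFSet.{0}) → Set ZFSet.{0}}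

/-- The one-sided infinitary form of the sequent `Γ ⇒ Δ` when `v` interprets the free variables. -/
noncomputable def sequent (v : ℕ → ZFSet.{0}) (Γ : Finset Formula) (Δ : Option Formula) :
    Set InfFml :=
  {X | (∃ A ∈ Γ, (A.toInf v Fin.elim0).dual = X) ∨ ∃ A ∈ Δ, A.toInf v Fin.elim0 = X}

theorem sequent_insert : sequent v (insert A Γ) Δ =
    insert (A.toInf v Fin.elim0).dual (sequent v Γ Δ) := by
  ext X
  simp only [sequent, Finset.exists_mem_insert, or_assoc, eq_comm (b := X), Set.mem_ofPred_eq,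
    Set.mem_insert_iff]

theorem sequent_some : sequent v Γ (some A) = insert (A.toInf v Fin.elim0) (sequent v Γ none) := by
  ext X
  simp [sequent, or_comm, eq_comm]

theorem sequent_none_subset : sequent v Γ none ⊆ sequent v Γ Δ := by
  rintro X (h | ⟨_, ⟨⟩, -⟩)
  exact .inl h

theorem mem_sequent_left (v : ℕ → ZFSet.{0}) (A : Formula) (Γ : Finset Formula)
    (Δ : Option Formula) : (A.toInf v Fin.elim0).dual ∈ sequent v (insert A Γ) Δ :=
  .inl ⟨A, Finset.mem_insert_self A Γ, rfl⟩

theorem mem_sequent_right (v : ℕ → ZFSet.{0}) (A : Formula) (Γ : Finset Formula) :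
    A.toInf v Fin.elim0 ∈ sequent v Γ (some A) :=
  .inr ⟨A, rfl, rfl⟩

theorem dependsOn_toInf_of_notMem (h : c ∉ A.fvs) :
    DependsOn (fun v => A.toInf v Fin.elim0) {c}ᶜ :=
  (A.dependsOn_toInf _).mono (Set.subset_compl_singleton_iff.2 (mod_cast h))

theorem Fresh.dependsOn_sequent (h : Fresh c Γ Δ) :
    DependsOn (fun v => sequent v Γ Δ) {c}ᶜ := by
  intro v v' hv
  ext X
  refine or_congr (exists_congr fun A => and_congr_right fun hA => ?_)
    (exists_congr fun A => and_congr_right fun hA => ?_)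
  · exact Eq.congr_left (congrArg dual (dependsOn_toInf_of_notMem (h.1 A hA) hv))
  · exact Eq.congr_left (dependsOn_toInf_of_notMem (h.2 A hA) hv)

theorem isGuard_mem (c b : ℕ) :
    IsGuard c (fun v => Fml.toInf v Fin.elim0 (.mem (.fv c) (.fv b))) fun v => {x | x ∈ v b} where
  isBdd _ := .atom _
  holds_iff _ _ := Iff.rfl
  rank_lt _ _ _ hv _ hx := (ZFSet.rank_lt_of_mem hx).trans (hv b)

theorem isGuard_funF (c a b : ℕ) :
    IsGuard c (fun v => (funF (.fv c) (.fv a) (.fv b)).toInf v Fin.elim0)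
      fun v => {x | ZFSet.IsFunc (v a) (v b) x} where
  isBdd _ := (isDelta0_funF ..).isBdd_toInf
  holds_iff _ _ := holds_toInf_funF ..
  rank_lt _ _ hξ hv _ := hξ.rank_lt_of_isFunc (hv a) (hv b)

/-- The embedding of the sequent `Γ ⇒ Δ` into the infinitary calculus with cut rank `k`. -/
def Embeds (k : ℕ) (Γ : Finset Formula) (Δ : Option Formula) : Prop :=
  UniformlyDerivable k fun v => sequent v Γ Δ

namespace Embeds

theorem left (h : Embeds k (insert A Γ) Δ) (Q : Formula) :
    UniformlyDerivable k fun v => insert (A.toInf v Fin.elim0).dual (sequent v (insert Q Γ) Δ) :=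
  UniformlyDerivable.mono h fun v => by
    simp only [sequent_insert]
    exact Set.insert_subset_insert (Set.subset_insert _ _)

theorem right (h : Embeds k Γ (some A)) (Δ : Option Formula) :
    UniformlyDerivable k fun v => insert (A.toInf v Fin.elim0) (sequent v Γ Δ) :=
  UniformlyDerivable.mono h fun v => by
    rw [sequent_some]
    exact Set.insert_subset_insert sequent_none_subset

theorem weaken_left (h : Embeds k Γ Δ) (Q : Formula) : Embeds k (insert Q Γ) Δ :=
  UniformlyDerivable.mono h fun v => by
    rw [sequent_insert]
    exact Set.subset_insert _ _

theorem and_left_left (h : Embeds k (insert A Γ) Δ) : Embeds k (insert (.and A B) Γ) Δ :=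
  UniformlyDerivable.or_left (fun v => by simpa [Fml.toInf] using mem_sequent_left v (.and A B) Γ Δ)
    (h.left _)

theorem and_left_right (h : Embeds k (insert B Γ) Δ) : Embeds k (insert (.and A B) Γ) Δ :=
  UniformlyDerivable.or_right
    (fun v => by simpa [Fml.toInf] using mem_sequent_left v (.and A B) Γ Δ) (h.left _)

theorem and_right (h : Embeds k Γ (some A)) (h' : Embeds k Γ (some B)) :
    Embeds k Γ (some (.and A B)) :=
  UniformlyDerivable.and (fun v => mem_sequent_right v (.and A B) Γ) (h.right _) (h'.right _)

theorem or_left (h : Embeds k (insert A Γ) Δ) (h' : Embeds k (insert B Γ) Δ) :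
    Embeds k (insert (.or A B) Γ) Δ :=
  UniformlyDerivable.and (fun v => by simpa [Fml.toInf] using mem_sequent_left v (.or A B) Γ Δ)
    (h.left _) (h'.left _)

theorem or_right_left (h : Embeds k Γ (some A)) : Embeds k Γ (some (.or A B)) :=
  UniformlyDerivable.or_left (fun v => mem_sequent_right v (.or A B) Γ) (h.right _)

theorem or_right_right (h : Embeds k Γ (some B)) : Embeds k Γ (some (.or A B)) :=
  UniformlyDerivable.or_right (fun v => mem_sequent_right v (.or A B) Γ) (h.right _)

theorem neg_left (h : Embeds k Γ (some A)) : Embeds k (insert (.neg A) Γ) none := by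
  simpa [Embeds, sequent_insert, sequent_some, Fml.toInf] using h

theorem neg_right (h : Embeds k (insert A Γ) none) : Embeds k Γ (some (.neg A)) := by
  simpa [Embeds, sequent_insert, sequent_some, Fml.toInf] using h

theorem imp_left (h : Embeds k (insert B Γ) Δ) (h' : Embeds k Γ (some A)) :
    Embeds k (insert (.imp A B) Γ) Δ :=
  UniformlyDerivable.and (fun v => by simpa [Fml.toInf] using mem_sequent_left v (.imp A B) Γ Δ)
    ((h'.weaken_left _).right _) (h.left _)

theorem imp_right (h : Embeds k (insert A Γ) (some B)) : Embeds k Γ (some (.imp A B)) := by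
  refine UniformlyDerivable.or (fun v => mem_sequent_right v (.imp A B) Γ) (h.mono fun v => ?_)
  rw [sequent_insert, sequent_some]
  exact Set.insert_subset_insert (Set.insert_subset_insert sequent_none_subset)

theorem cut (hA : A.code ≤ k) (h : Embeds k Γ (some A)) (h' : Embeds k (insert A Γ) Δ) :
    Embeds k Γ Δ :=
  UniformlyDerivable.cut (fun v => (A.rankLE_toInf v Fin.elim0).mono hA) (h.right Δ)
    (by simpa only [Embeds, sequent_insert] using h')

theorem all_left (h : Embeds k (insert (F.app (.fv c)) Γ) Δ) : Embeds k (insert (.all F) Γ) Δ :=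
  UniformlyDerivable.disj (fun v => mem_sequent_left v (.all F) Γ Δ)
    (by simpa only [Fml.toInf_app, Tm.eval_fv] using h.left (.all F))

theorem all_right (hc : Fresh c Γ (some (.all F))) (h : Embeds k Γ (some (F.app (.fv c)))) :
    Embeds k Γ (some (.all F)) :=
  UniformlyDerivable.conj hc.dependsOn_sequent (dependsOn_toInf_of_notMem (hc.2 _ rfl))
    (fun v => mem_sequent_right v (.all F) Γ)
    (by simpa only [Fml.toInf_app, Tm.eval_fv] using h.right (some (.all F)))

theorem ex_left (hc : Fresh c (insert (.ex F) Γ) Δ) (h : Embeds k (insert (F.app (.fv c)) Γ) Δ) :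
    Embeds k (insert (.ex F) Γ) Δ :=
  UniformlyDerivable.conj hc.dependsOn_sequent
    (fun _ _ hv => congrArg dual
      (dependsOn_toInf_of_notMem (hc.1 _ (Finset.mem_insert_self _ _)) hv))
    (fun v => mem_sequent_left v (.ex F) Γ Δ)
    (by simpa only [Fml.toInf_app, Tm.eval_fv] using h.left (.ex F))

theorem ex_right (h : Embeds k Γ (some (F.app (.fv c)))) : Embeds k Γ (some (.ex F)) :=
  UniformlyDerivable.disj (fun v => mem_sequent_right v (.ex F) Γ)
    (by simpa only [Fml.toInf_app, Tm.eval_fv] using h.right (some (.ex F)))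

theorem guarded_forall_left (hG : IsGuard c (fun v => G.toInf v Fin.elim0) S)
    (hQ : ∀ v, Q.toInf v Fin.elim0 =
      .conj (some (S v)) fun x => F.toInf v (Fin.cons x Fin.elim0))
    (h : Embeds k (insert (.imp G (F.app (.fv c))) Γ) Δ) : Embeds k (insert Q Γ) Δ :=
  UniformlyDerivable.guarded_disj hG
    (fun v => by simpa only [hQ, dual] using mem_sequent_left v Q Γ Δ)
    (by simpa only [Fml.toInf, Fml.toInf_app, Tm.eval_fv, dual_or, dual_dual] using h.left Q)

theorem guarded_forall_right (hG : IsGuard c (fun v => G.toInf v Fin.elim0) S)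
    (hQ : ∀ v, Q.toInf v Fin.elim0 =
      .conj (some (S v)) fun x => F.toInf v (Fin.cons x Fin.elim0))
    (hc : Fresh c Γ (some Q)) (h : Embeds k Γ (some (.imp G (F.app (.fv c))))) :
    Embeds k Γ (some Q) :=
  UniformlyDerivable.guarded_conj hG hc.dependsOn_sequent
    (by simpa only [hQ] using dependsOn_toInf_of_notMem (hc.2 Q rfl))
    (fun v => by simpa only [hQ] using mem_sequent_right v Q Γ)
    (by simpa only [Fml.toInf, Fml.toInf_app, Tm.eval_fv] using h.right (some Q))

theorem guarded_exists_left (hG : IsGuard c (fun v => G.toInf v Fin.elim0) S)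
    (hQ : ∀ v, Q.toInf v Fin.elim0 =
      .disj (some (S v)) fun x => F.toInf v (Fin.cons x Fin.elim0))
    (hc : Fresh c (insert Q Γ) Δ) (h : Embeds k (insert (.and G (F.app (.fv c))) Γ) Δ) :
    Embeds k (insert Q Γ) Δ :=
  UniformlyDerivable.guarded_conj hG hc.dependsOn_sequent
    (fun v v' hv => by
      simpa only [hQ, dual] using congrArg dual
        (dependsOn_toInf_of_notMem (hc.1 Q (Finset.mem_insert_self Q Γ)) hv))
    (fun v => by simpa only [hQ, dual] using mem_sequent_left v Q Γ Δ)
    (by simpa only [Fml.toInf, Fml.toInf_app, Tm.eval_fv, dual_and] using h.left Q)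

theorem guarded_exists_right (hG : IsGuard c (fun v => G.toInf v Fin.elim0) S)
    (hQ : ∀ v, Q.toInf v Fin.elim0 =
      .disj (some (S v)) fun x => F.toInf v (Fin.cons x Fin.elim0))
    (h : Embeds k Γ (some (.and G (F.app (.fv c))))) : Embeds k Γ (some Q) :=
  UniformlyDerivable.guarded_disj hG (fun v => by simpa only [hQ] using mem_sequent_right v Q Γ)
    (by simpa only [Fml.toInf, Fml.toInf_app, Tm.eval_fv] using h.right (some Q))

theorem of_isDelta0 (hA : A.IsDelta0) (h : ∀ ξ v, (A.toInf v Fin.elim0).Holds ξ) :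
    Embeds k Γ (some A) :=
  UniformlyDerivable.of_holds (fun v => mem_sequent_right v A Γ) (fun _ => hA.isBdd_toInf)
    fun ξ v _ _ => h ξ v

theorem ex_of_holds (hF : F.IsDelta0)
    (h : ∀ ξ v, IsCountableEpsilon ξ → (∀ i, (v i).rank < ξ) →
      ∃ x : ZFSet.{0}, x.rank < ξ ∧ (F.toInf v (Fin.cons x Fin.elim0)).Holds ξ) :
    Embeds k Γ (some (.ex F)) :=
  UniformlyDerivable.of_exists_holds (fun v => mem_sequent_right v (.ex F) Γ)
    (fun _ _ => hF.isBdd_toInf) h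

theorem logical (A : Formula) : Embeds k (insert A Γ) (some A) :=
  UniformlyDerivable.excluded_middle (fun v => A.rankLE_toInf v Fin.elim0)
    (fun v => mem_sequent_right v A _) fun v => mem_sequent_left v A Γ _

theorem ext {B : Fml 1} (a b : ℕ) (hB : B.IsDelta0) : Embeds k Γ (some (extAx a b B)) := by
  refine of_isDelta0 (by simp [extAx, eqF, Fml.IsDelta0, Fml.app, Fml.isDelta0_subst, hB])
    fun ξ v => ?_
  simp only [extAx, Fml.toInf, Fml.toInf_app, Tm.eval_fv, holds_or, holds_dual, holds_and,
    holds_toInf_eqF, ← imp_iff_not_or]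
  rintro ⟨hab, h⟩
  rwa [← hab]

theorem pair (a b : ℕ) : Embeds k Γ (some (pairAx a b)) :=
  ex_of_holds (by simp [Fml.IsDelta0]) fun ξ v hξ hv => by
    refine ⟨{v a, v b}, ?_, by simp [Fml.toInf, Holds]⟩
    rw [ZFSet.rank_pair]
    exact max_lt (hξ.add_one_lt (hv a)) (hξ.add_one_lt (hv b))

theorem union (a : ℕ) : Embeds k Γ (some (unionAx a)) :=
  ex_of_holds (by simp [Fml.IsDelta0]) fun _ v _ hv =>
    ⟨ZFSet.sUnion (v a), (ZFSet.rank_sUnion_le _).trans_lt (hv a),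
      fun y hy _ hz => ZFSet.mem_sUnion.2 ⟨y, hy, hz⟩⟩

theorem infinity : Embeds k Γ (some infAx) :=
  ex_of_holds (by simp [Fml.IsDelta0]) fun ξ v hξ _ => by
    refine ⟨ZFSet.vonNeumann ω, by simpa using hξ.omega0_lt, ?_⟩
    simp only [Fml.toInf, holds_and, Holds, range_some, Set.mem_ofPred_eq, Tm.eval_bv,
      Fin.cons_zero, Fin.cons_one, ZFSet.mem_vonNeumann]
    exact ⟨⟨∅, by simp, by simp⟩, fun y hy =>
      ⟨{y}, by simpa using isSuccLimit_omega0.succ_lt hy, ZFSet.mem_singleton.2 rfl⟩⟩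

theorem separation {B : Fml 1} (a : ℕ) (hB : B.IsDelta0) : Embeds k Γ (some (sepAx a B)) :=
  ex_of_holds (by simp [Fml.IsDelta0, Fml.app, Fml.isDelta0_subst, hB]) fun ξ v _ hv => by
    refine ⟨ZFSet.sep (fun y => (B.toInf v (Fin.cons y Fin.elim0)).Holds ξ) (v a),
      (ZFSet.rank_mono fun y hy => (ZFSet.mem_sep.1 hy).1).trans_lt (hv a), ?_⟩
    simp only [Fml.toInf, Fml.toInf_app, holds_and, holds_or, holds_dual, Holds, range_some,
      Set.mem_ofPred_eq, Tm.eval_fv, Tm.eval_bv, Fin.cons_zero, Fin.cons_one, ZFSet.mem_sep,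
      ← imp_iff_not_or]
    exact ⟨fun _ hy => hy, fun _ hy h => ⟨hy, h⟩⟩

theorem exponentiation (a b : ℕ) : Embeds k Γ (some (expAx a b)) :=
  ex_of_holds (by simp [Fml.IsDelta0]) fun ξ v hξ hv => by
    refine ⟨ZFSet.funs (v a) (v b), ?_, fun _ hx => ZFSet.mem_funs.2 hx⟩
    refine (ZFSet.rank_le_iff.2 fun x hx => Order.lt_add_one_iff.2
      (rank_le_of_isFunc (ZFSet.mem_funs.1 hx))).trans_lt ?_
    exact hξ.add_one_lt (hξ.add_lt (max_lt (hv a) (hv b)) (mod_cast hξ.natCast_lt 2))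

theorem collection {B : Fml 2} (a : ℕ) (hB : B.IsDelta0) : Embeds k Γ (some (collAx a B)) := by
  refine UniformlyDerivable.or (fun v => mem_sequent_right v (collAx a B) Γ) ?_
  refine UniformlyDerivable.collection (S := fun v => {x | x ∈ v a})
    (B := fun v x y => B.toInf v ![y, x]) (fun _ _ _ => hB.isBdd_toInf) (fun v => ?_) fun v => ?_
  all_goals simp [Fml.toInf, Fml.toInf_app₂]

theorem induction (G : Fml 1) : Embeds k Γ (some (indAx G)) := by
  refine UniformlyDerivable.or (fun v => mem_sequent_right v (indAx G) Γ) ?_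
  refine UniformlyDerivable.set_induction (F := fun v x => G.toInf v (Fin.cons x Fin.elim0))
    (fun v x => G.rankLE_toInf v _) (fun v => ?_) fun v => ?_
  all_goals simp [Fml.toInf, Fml.toInf_app, dual]

theorem of_deriv (d : Deriv Γ Δ) (hk : d.code ≤ k) : Embeds k Γ Δ := by
  have le_of_mem {l : List ℕ} {p : ℕ} (h : seqCode l ≤ k) (hp : p ∈ l := by simp) : p ≤ k :=
    (lt_seqCode hp).le.trans h
  induction d with
  | logical Γ A => exact logical A
  | ext Γ a b B hB => exact ext a b hB
  | pair Γ a b => exact pair a b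
  | union Γ a => exact union a
  | infinity => exact infinity
  | sep Γ a B hB => exact separation a hB
  | coll Γ a B hB => exact collection a hB
  | ind Γ G => exact induction G
  | exp Γ a b => exact exponentiation a b
  | andL₁ _ _ _ _ d ih => exact (ih (le_of_mem hk)).and_left_left
  | andL₂ _ _ _ _ d ih => exact (ih (le_of_mem hk)).and_left_right
  | andR _ _ _ d e ih ih' => exact (ih (le_of_mem hk)).and_right (ih' (le_of_mem hk))
  | orL _ _ _ _ d e ih ih' => exact (ih (le_of_mem hk)).or_left (ih' (le_of_mem hk))
  | orR₁ _ _ _ d ih => exact (ih (le_of_mem hk)).or_right_left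
  | orR₂ _ _ _ d ih => exact (ih (le_of_mem hk)).or_right_right
  | negL _ _ d ih => exact (ih (le_of_mem hk)).neg_left
  | negR _ _ d ih => exact (ih (le_of_mem hk)).neg_right
  | bot _ _ d ih => exact (ih (le_of_mem hk)).mono fun _ => sequent_none_subset
  | impL _ _ _ _ d e ih ih' => exact (ih (le_of_mem hk)).imp_left (ih' (le_of_mem hk))
  | impR _ _ _ d ih => exact (ih (le_of_mem hk)).imp_right
  | bexL Γ Δ a b F h d ih =>
    exact (ih (le_of_mem hk)).guarded_exists_left (isGuard_mem a b) (fun _ => rfl) h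
  | bexR Γ a b F d ih =>
    exact (ih (le_of_mem hk)).guarded_exists_right (isGuard_mem a b) fun _ => rfl
  | ballL Γ Δ a b F d ih =>
    exact (ih (le_of_mem hk)).guarded_forall_left (isGuard_mem a b) fun _ => rfl
  | ballR Γ a b F h d ih =>
    exact (ih (le_of_mem hk)).guarded_forall_right (isGuard_mem a b) (fun _ => rfl) h
  | exL Γ Δ a F h d ih => exact (ih (le_of_mem hk)).ex_left h
  | exR Γ a F d ih => exact (ih (le_of_mem hk)).ex_right
  | allL Γ Δ a F d ih => exact (ih (le_of_mem hk)).all_left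
  | allR Γ a F h d ih => exact (ih (le_of_mem hk)).all_right h
  | eexL Γ Δ c a b F h d ih =>
    exact (ih (le_of_mem hk)).guarded_exists_left (isGuard_funF c a b) (fun _ => rfl) h
  | eexR Γ c a b F d ih =>
    exact (ih (le_of_mem hk)).guarded_exists_right (isGuard_funF c a b) fun _ => rfl
  | eallL Γ Δ c a b F d ih =>
    exact (ih (le_of_mem hk)).guarded_forall_left (isGuard_funF c a b) fun _ => rfl
  | eallR Γ c a b F h d ih =>
    exact (ih (le_of_mem hk)).guarded_forall_right (isGuard_funF c a b) (fun _ => rfl) h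
  | cut Γ Δ A d e ih ih' => exact cut (le_of_mem hk) (ih (le_of_mem hk)) (ih' (le_of_mem hk))

end Embeds

end Embedding

/-! ### Bounding Σ theorems -/

section Bounding

variable {ξ α : Ordinal.{0}} {k n : ℕ} {v : ℕ → ZFSet.{0}} {A : Formula}

theorem empty_mem_EHier_psi (α : Ordinal.{0}) : ∅ ∈ EHier (psi α) := by
  rw [(isCountableEpsilon_psi α).EHier_eq]
  simpa using (isCountableEpsilon_psi α).pos

theorem InfDeriv.eliminate_all {Γ : Set InfFml} (hξ : IsCountableEpsilon ξ)
    (h : InfDeriv k ξ α Γ) (hα : α ≤ (towerTerm n).val) :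
    InfDeriv 0 ξ (towerTerm (n + k)).val Γ := by
  induction k generalizing n α with
  | zero => exact h.mono_height hα
  | succ k ih =>
    rw [← Nat.succ_add_eq_add_succ]
    refine ih (h.eliminate hξ) ?_
    rw [val_towerTerm_succ]
    exact opow_le_opow_right omega0_pos hα

theorem Embeds.sat_EHier_psi (h : Embeds k ∅ (some A)) (hA : IsSigma A) (p : ℕ)
    (hv : ∀ i, v i ∈ EHier (psi (towerTerm p).val)) :
    Sat (EHier (psi (towerTerm (p + k + 3)).val)) v Fin.elim0 A := by
  have hγ := isCountableEpsilon_psi (towerTerm p).val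
  have hδ := isCountableEpsilon_psi (towerTerm (p + k + 3)).val
  obtain ⟨m, h⟩ := h
  rw [hγ.EHier_eq] at hv
  have hsig := InClass.isSig_toInf hA v Fin.elim0
  have hcutfree := (h _ v hγ hv).eliminate_all hγ (Om_add_natCast_lt_val_towerTerm m).le
  have hsequent : sequent v ∅ (some A) = {A.toInf v Fin.elim0} := by simp [sequent, eq_comm]
  beta_reduce at hcutfree
  rw [hsequent] at hcutfree
  obtain ⟨_, rfl, hholds⟩ := InfDeriv.collapses _ (val_towerTerm_mem_BSet _ p)
    (by simpa using hsig) hcutfree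
  rw [← val_towerTerm_succ] at hholds
  have hle : psi ((towerTerm p).val + (towerTerm (1 + k + 1)).val) ≤
      psi (towerTerm (p + k + 3)).val :=
    psi_mono (val_towerTerm_add_lt (by omega) (by omega)).le
  have hpsi : psi (towerTerm p).val ≤ psi (towerTerm (p + k + 3)).val :=
    psi_mono (strictMono_val_towerTerm.monotone (by omega))
  rw [hδ.EHier_eq]
  exact (A.holds_toInf_iff hδ (fun i => (hv i).trans_le hpsi) fun i => i.elim0).1
    (hsig.holds_mono hle hholds)

end Bounding

end IKPE

theorem mainTheorem2_general :
    ∃ f : ℕ → ℕ → ℕ, Computable₂ f ∧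
      ∀ (A : IKPE.Formula), IKPE.IsSigma A →
        ∀ (d : IKPE.Deriv ∅ (some A)) (p : ℕ),
          ∃ t : IKPE.OTerm, f p d.code = t.code ∧ t.IsNF ∧
            t.val < IKPE.psi IKPE.epsOm ∧
            ∀ v : ℕ → ZFSet.{0}, (∀ i, v i ∈ IKPE.EHier (IKPE.psi (IKPE.towerTerm p).val)) →
              IKPE.Sat (IKPE.EHier t.val) v Fin.elim0 A := by
  refine ⟨fun p c => (IKPE.OTerm.psi (IKPE.towerTerm (p + c + 3))).code, ?_, fun A hA d p => ?_⟩
  · exact (IKPE.primrec_code_psi_towerTerm.comp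
      (Primrec.nat_add.comp Primrec.nat_add (Primrec.const 3))).to_comp
  · exact ⟨_, rfl, IKPE.isNF_psi_towerTerm _, IKPE.psi_val_towerTerm_lt _, fun v hv =>
      (IKPE.Embeds.of_deriv d le_rfl).sat_EHier_psi hA p hv⟩

/-- One computable function maps (the Gödel number of) each derivation in `IKP(𝓔)` of a sequent
`⇒ A`, with `A` a `Σ^𝓔`-sentence, to (the Gödel number of) an ordinal term denoting an
`α < ψ_Ω(ε_{Ω+1})` such that `E_α ⊨ A`. -/
theorem mainTheorem2 :
    ∃ f : ℕ → ℕ, Computable f ∧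
      ∀ (A : IKPE.Formula), IKPE.IsSentence A → IKPE.IsSigma A →
        ∀ d : IKPE.Deriv ∅ (some A),
          ∃ t : IKPE.OTerm, f d.code = t.code ∧ t.IsNF ∧
            t.val < IKPE.psi IKPE.epsOm ∧
            IKPE.Models (IKPE.EHier t.val) A := by
  obtain ⟨f, hf, h⟩ := mainTheorem2_general
  refine ⟨f 0, hf.comp (Computable.const 0) Computable.id, fun A _ hA d => ?_⟩
  obtain ⟨t, hcode, hnf, hlt, hsat⟩ := h A hA d 0
  exact ⟨t, hcode, hnf, hlt, hsat _ fun _ => IKPE.empty_mem_EHier_psi _⟩
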